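/- Let $\mathcal H$ be a complex separable Hilbert space and let $A$ be a compact operator on $\mathcal H$ with $\|A\|<1$. For a bounded operator $T$ write $|T|=(T^*T)^{1/2}$. Let $B$ be a norm limit point of the sequence $(|A^n|^{1/n})_{n\ge 1}$, that is, the limit in operator norm of some subsequence. Then $$\sigma(B)=\{|\lambda| : \lambda\in\sigma(A)\}.$$ Moreover, for every $\lambda\in\mathbb C$ with $\lambda\neq 0$, the set of $\eta\in\sigma(A)$ with $|\eta|=|\lambda|$ is finite, each such $\eta$ has finite algebraic multiplicity $$m_A(\eta)=\dim\{x\in\mathcal H : (A-\eta I)^r x=0 \text{ for some } r\ge 1\},$$ the space $\ker(B-|\lambda| I)$ is finite dimensional, and $$\dim\ker(B-|\lambda| I)=\sum_{\eta\in\sigma(A),\ |\eta|=|\lambda|} m_A(\eta).$$ -/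

import Mathlib

open Filter Topology

noncomputable section

/-- The operator `|Aⁿ|^{1/n}` (for `n ≥ 1`), where `|T|` is the positive square root of `T* T` and
the power of a positive operator is given by the continuous functional calculus. -/
def absPowRoot {H : Type*} [NormedAddCommGroup H] [InnerProductSpace ℂ H] [CompleteSpace H]
    (A : H →L[ℂ] H) (n : ℕ) : H →L[ℂ] H :=
  CFC.abs (A ^ n) ^ (1 / (n : ℝ))

/-- The set of all norm limit points of the sequence `|Aⁿ|^{1/n}`, i.e. of all limits, in operator
norm, of its subsequences. -/
def normLimitPoints {H : Type*} [NormedAddCommGroup H] [InnerProductSpace ℂ H] [CompleteSpace H]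
    (A : H →L[ℂ] H) : Set (H →L[ℂ] H) :=
  {B | ∃ φ : ℕ → ℕ, StrictMono φ ∧ Tendsto (fun k => absPowRoot A (φ k)) atTop (𝓝 B)}

/-- The root space of `A` at `η`: all `x` with `(A - η)^r x = 0` for some `r`. -/
def rootSpace {H : Type*} [NormedAddCommGroup H] [InnerProductSpace ℂ H]
    (A : H →L[ℂ] H) (η : ℂ) : Submodule ℂ H :=
  Module.End.maxGenEigenspace (A : H →ₗ[ℂ] H) η

/-- The algebraic multiplicity of `η`: the dimension of the root space of `A` at `η`
(meaningful when that space is finite dimensional). -/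
def algMultiplicity {H : Type*} [NormedAddCommGroup H] [InnerProductSpace ℂ H]
    (A : H →L[ℂ] H) (η : ℂ) : ℕ :=
  Module.finrank ℂ (rootSpace A η)

end

/-! For ρ > 0, let W(ρ) be the space of vectors whose orbit under A is O(sⁿ) for some s < ρ
(`slowSpace`). Riesz theory makes W(ρ) the kernel of a finite-rank projection commuting with A,
whose range is the sum of the root spaces with |η| ≥ ρ. So W(ρ) is closed, and its codimension is
the sum of the multiplicities over |η| ≥ ρ. The orbit growth is uniform: strictly slower than ρⁿ on
W(ρ), and at least about cⁿ, for every c < ρ, on the range of the projection.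

Such bounds on ‖Aⁿx‖ are inequalities between (Aⁿ)*Aⁿ and the 2n-th power of an operator that is
scalar on W(ρ) and on its orthogonal complement. Operator monotonicity of t ↦ t^{1/(2n)} turns them
into bounds on |Aⁿ|^{1/n} that survive the limit: ⟨Bx,x⟩ ≤ a‖x‖² on W(ρ) for some a < ρ, and B ≥ ρQ,
with Q the orthogonal projection onto W(ρ)ᗮ.

Let r > ρ be such that no spectral modulus lies in (ρ, r). The two bounds pinch B to the scalar ρ on
W(r) ∩ W(ρ)ᗮ, and this is the whole eigenspace (`ker_sub_smul_eq`). Its dimension is a difference of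
two codimensions, namely the sum of the multiplicities over |η| = ρ. The same bounds make B compact,
so its nonzero spectrum consists of eigenvalues; the point 0 is settled by showing that A is
invertible exactly when B is. -/

/-! ### Riesz theory: chains of subspaces, ascent, projection onto a kernel -/

theorem not_isCompactOperator_of_strictMono_chain {H : Type*} [NormedAddCommGroup H]
    [InnerProductSpace ℂ H] [CompleteSpace H] {K : H →L[ℂ] H} {V : ℕ → Submodule ℂ H}
    (hV : StrictMono V) (hclosed : ∀ n, IsClosed (V n : Set H)) {c : ℕ → ℂ} {ρ : ℝ} (hρ : 0 < ρ)
    (hc : ∀ n, ρ ≤ ‖c n‖) (hKV : ∀ n, ∀ x ∈ V (n + 1), K x - c n • x ∈ V n) :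
    ¬ IsCompactOperator K := by
  intro hK
  have hex : ∀ n, ∃ u ∈ V (n + 1), ‖u‖ = 1 ∧ ∀ y ∈ V n, inner ℂ u y = 0 := by
    intro n
    have : CompleteSpace (V n) := (hclosed n).completeSpace_coe
    obtain ⟨x, hx, hxn⟩ := SetLike.exists_of_lt (hV (Nat.lt_succ_self n))
    set w := x - (V n).starProjection x with hw
    have hw0 : w ≠ 0 := by
      intro h
      apply hxn
      rw [sub_eq_zero.mp h]
      exact (V n).starProjection_apply_mem x
    have hwV : w ∈ V (n + 1) :=
      sub_mem hx (hV.monotone (Nat.le_succ n) ((V n).starProjection_apply_mem x))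
    have hworth : ∀ y ∈ V n, inner ℂ w y = 0 := fun y hy =>
      (V n).starProjection_inner_eq_zero x y hy
    refine ⟨((‖w‖⁻¹ : ℝ) : ℂ) • w, Submodule.smul_mem _ _ hwV, ?_, fun y hy => ?_⟩
    · rw [norm_smul, Complex.norm_real, norm_inv, norm_norm]
      exact inv_mul_cancel₀ (norm_ne_zero_iff.mpr hw0)
    · rw [inner_smul_left, hworth y hy, mul_zero]
  choose u huV hu1 hu0 using hex
  have hKu : ∀ n, K (u n) ∈ V (n + 1) := fun n => by
    have h := add_mem (hV.monotone (Nat.le_succ n) (hKV n _ (huV n)))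
      (Submodule.smul_mem _ (c n) (huV n))
    simpa using h
  -- Modulo `V n`, which is orthogonal to `u n`, the difference is `c n • u n`; so the images of the
  -- unit vectors are ρ-separated and have no convergent subsequence.
  have hsep : ∀ m n, m < n → ρ ≤ ‖K (u n) - K (u m)‖ := by
    intro m n hmn
    have hv : K (u n) - c n • u n - K (u m) ∈ V n :=
      sub_mem (hKV n _ (huV n)) (hV.monotone hmn (hKu m))
    have h1 : inner ℂ (u n) (K (u n) - K (u m)) = c n := by
      have : K (u n) - K (u m) = c n • u n + (K (u n) - c n • u n - K (u m)) := by abel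
      rw [this, inner_add_right, hu0 n _ hv, inner_smul_right, inner_self_eq_norm_sq_to_K, hu1]
      simp
    calc ρ ≤ ‖c n‖ := hc n
      _ = ‖inner ℂ (u n) (K (u n) - K (u m))‖ := by rw [h1]
      _ ≤ ‖u n‖ * ‖K (u n) - K (u m)‖ := norm_inner_le_norm _ _
      _ = _ := by rw [hu1, one_mul]
  obtain ⟨L, hL, hL'⟩ := hK.image_closedBall_subset_compact 1
  obtain ⟨y, -, ψ, hψ, hψy⟩ :=
    hL.tendsto_subseq (fun n => hL' ⟨u n, by simp [hu1], rfl⟩ : ∀ n, K (u n) ∈ L)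
  obtain ⟨N, hN⟩ := Metric.cauchySeq_iff'.mp hψy.cauchySeq ρ hρ
  have h := hN (N + 1) (Nat.le_succ N)
  rw [dist_eq_norm] at h
  exact absurd (hsep _ _ (hψ (Nat.lt_succ_self N))) (not_le.mpr h)

section Riesz

variable {H : Type*} [NormedAddCommGroup H] [InnerProductSpace ℂ H]

theorem exists_ker_pow_eq_of_isCompactOperator_sub [CompleteSpace H] {T : H →L[ℂ] H} {c : ℂ}
    (hc : c ≠ 0)
    (hT : IsCompactOperator (T - c • (1 : H →L[ℂ] H))) :
    ∃ k, ∀ m, k ≤ m → LinearMap.ker ((T : H →ₗ[ℂ] H) ^ m) = LinearMap.ker ((T : H →ₗ[ℂ] H) ^ k) := by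
  by_contra hcon
  have hne : ∀ n, LinearMap.ker ((T : H →ₗ[ℂ] H) ^ n) ≠ LinearMap.ker ((T : H →ₗ[ℂ] H) ^ (n + 1)) := by
    intro n hn
    apply hcon
    refine ⟨n, fun m hm => ?_⟩
    obtain ⟨j, rfl⟩ := Nat.exists_eq_add_of_le hm
    exact (Module.End.ker_pow_constant hn j).symm
  have hle : ∀ n, LinearMap.ker ((T : H →ₗ[ℂ] H) ^ n) ≤ LinearMap.ker ((T : H →ₗ[ℂ] H) ^ (n + 1)) := by
    intro n x hx
    rw [LinearMap.mem_ker] at hx ⊢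
    rw [pow_succ', Module.End.mul_apply, hx, map_zero]
  -- With K = T - c, the vector Kx - (-c)x is Tx, and T lowers the chain of kernels by one.
  refine not_isCompactOperator_of_strictMono_chain
    (strictMono_nat_of_lt_succ fun n => lt_of_le_of_ne (hle n) (hne n))
    (fun n => ?_) (norm_pos_iff.mpr hc) (c := fun _ => -c) (fun n => (norm_neg c).ge) ?_ hT
  · have : LinearMap.ker ((T : H →ₗ[ℂ] H) ^ n) = LinearMap.ker (T ^ n : H →L[ℂ] H).toLinearMap := by
      rw [ContinuousLinearMap.toLinearMap_pow]
    rw [this]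
    exact (T ^ n).isClosed_ker
  · intro n x hx
    have : (T - c • (1 : H →L[ℂ] H)) x - (-c) • x = T x := by simp
    rw [this]
    rw [LinearMap.mem_ker, pow_succ, Module.End.mul_apply] at hx
    exact hx

theorem finiteDimensional_ker_of_isCompactOperator_sub {T : H →L[ℂ] H} {c : ℂ} (hc : c ≠ 0)
    (hT : IsCompactOperator (T - c • (1 : H →L[ℂ] H))) :
    FiniteDimensional ℂ (LinearMap.ker T.toLinearMap) := by
  apply FiniteDimensional.of_isCompactOperator_id
  have h1 : IsCompactOperator ((-c⁻¹) • (T - c • (1 : H →L[ℂ] H))) := hT.smul _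
  have h2 : IsCompactOperator (fun x : LinearMap.ker T.toLinearMap =>
      ((-c⁻¹) • (T - c • (1 : H →L[ℂ] H))) (x : H)) :=
    h1.comp_clm (LinearMap.ker T.toLinearMap).subtypeL
  have h3 : ∀ x : LinearMap.ker T.toLinearMap,
      ((-c⁻¹) • (T - c • (1 : H →L[ℂ] H))) (x : H) = x := by
    intro x
    have hx : T (x : H) = 0 := x.2
    simp [hx, smul_smul, hc]
  have h4 := h2.codRestrict (V := LinearMap.ker T.toLinearMap)
    (fun x => by rw [h3]; exact x.2) T.isClosed_ker
  have h5 : (id : LinearMap.ker T.toLinearMap → LinearMap.ker T.toLinearMap) =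
      Set.codRestrict (fun x : LinearMap.ker T.toLinearMap =>
        ((-c⁻¹) • (T - c • (1 : H →L[ℂ] H))) (x : H))
        (LinearMap.ker T.toLinearMap) (fun x => by rw [h3]; exact x.2) :=
    funext fun x => Subtype.ext (h3 x).symm
  rw [h5]
  exact h4

/-- Ascent at most one gives H = ker T ⊕ range T. With Q the orthogonal projection onto ker T, the
operator T + Q is a nonzero scalar plus a compact operator and is injective, hence invertible by the
Fredholm alternative. The oblique projection is Q(T + Q)⁻¹, and no contour integral is needed. -/
theorem exists_projection_ker_range [CompleteSpace H] {T : H →L[ℂ] H} {c : ℂ} (hc : c ≠ 0)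
    (hT : IsCompactOperator (T - c • (1 : H →L[ℂ] H)))
    (hker : ∀ x, T (T x) = 0 → T x = 0) :
    ∃ Pr : H →L[ℂ] H, (∀ y, T (Pr y) = 0) ∧ (∀ x, T x = 0 → Pr x = x) ∧
      (∀ y, ∃ z, y - Pr y = T z) ∧ ∀ z, Pr (T z) = 0 := by
  have hfd := finiteDimensional_ker_of_isCompactOperator_sub hc hT
  set F := LinearMap.ker T.toLinearMap with hF
  set Q := F.starProjection with hQ
  have hTQ : ∀ x, T (Q x) = 0 := fun x => F.starProjection_apply_mem x
  have hQx : ∀ x, T x = 0 → Q x = x := fun x hx =>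
    F.starProjection_eq_self_iff.mpr (show x ∈ F from hx)
  have hQc : IsCompactOperator Q := by
    have : ProperSpace F := FiniteDimensional.proper ℂ F
    have h := (isCompactOperator_of_locallyCompactSpace_rng F.subtypeL).comp_clm
      F.orthogonalProjectionOnto
    exact h
  have hRc : IsCompactOperator (T + Q - c • (1 : H →L[ℂ] H)) := by
    have h := hT.add hQc
    have heq : ⇑(T + Q - c • (1 : H →L[ℂ] H)) = ⇑(T - c • (1 : H →L[ℂ] H)) + ⇑Q := by
      funext x
      simp only [sub_apply, add_apply, Pi.add_apply]
      abel
    rw [heq]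
    exact h
  have hunit : IsUnit (T + Q) := by
    rcases hRc.hasEigenvalue_or_mem_resolventSet (neg_ne_zero.mpr hc) with h | h
    · exfalso
      obtain ⟨x, hx⟩ := h.exists_hasEigenvector
      have h1 := hx.apply_eq_smul
      have h2 : T x + Q x = 0 := by
        simpa [sub_eq_iff_eq_add] using h1
      have h3 : T x = 0 := by
        apply hker
        have := congrArg T h2
        simpa [hTQ] using this
      have h4 : x = 0 := by
        rw [h3, zero_add, hQx x h3] at h2
        exact h2
      exact hx.2 h4
    · rw [spectrum.mem_resolventSet_iff] at h
      have h' := h.neg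
      convert h' using 1
      ext x
      simp [Algebra.algebraMap_eq_smul_one]
  obtain ⟨R, hR⟩ := hunit
  have hRR : ∀ x, T ((↑R⁻¹ : H →L[ℂ] H) x) + Q ((↑R⁻¹ : H →L[ℂ] H) x) = x := fun x => by
    have h := R.mul_inv
    rw [hR] at h
    exact congrArg (fun f : H →L[ℂ] H => f x) h
  have hRR' : ∀ x, (↑R⁻¹ : H →L[ℂ] H) (T x + Q x) = x := fun x => by
    have h := R.inv_mul
    rw [hR] at h
    exact congrArg (fun f : H →L[ℂ] H => f x) h
  refine ⟨Q * ↑R⁻¹, fun y => hTQ _, fun x hx => ?_, fun y => ⟨(↑R⁻¹ : H →L[ℂ] H) y, ?_⟩,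
    fun z => ?_⟩
  · have := hRR' x
    rw [hx, zero_add, hQx x hx] at this
    change Q ((↑R⁻¹ : H →L[ℂ] H) x) = x
    rw [this, hQx x hx]
  · change y - Q ((↑R⁻¹ : H →L[ℂ] H) y) = _
    exact sub_eq_iff_eq_add.mpr (hRR y).symm
  · change Q ((↑R⁻¹ : H →L[ℂ] H) (T z)) = 0
    have hQQ : Q (Q z) = Q z := hQx _ (hTQ z)
    have := hRR' (z - Q z)
    rw [map_sub, map_sub, hTQ, hQQ, sub_zero, sub_self, add_zero] at this
    rw [this, map_sub, hQQ, sub_self]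

end Riesz

/-! ### Gelfand's formula and kernels of polynomials in an operator -/

theorem eventually_norm_pow_le_of_spectrum_lt {𝔸 : Type*} [NormedRing 𝔸] [NormedAlgebra ℂ 𝔸]
    [CompleteSpace 𝔸] (a : 𝔸) {ρ : ℝ} (hρ : 0 < ρ) (h : ∀ z ∈ spectrum ℂ a, ‖z‖ < ρ) :
    ∃ s, 0 < s ∧ s < ρ ∧ ∀ᶠ n : ℕ in atTop, ‖a ^ n‖ ≤ s ^ n := by
  rcases subsingleton_or_nontrivial 𝔸 with hs | hn
  · refine ⟨ρ / 2, by positivity, by linarith, Eventually.of_forall fun n => ?_⟩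
    rw [Subsingleton.elim (a ^ n) 0, norm_zero]
    positivity
  · have h1 : spectralRadius ℂ a < (ρ.toNNReal : ENNReal) :=
      spectrum.spectralRadius_lt_of_forall_lt a fun z hz => by
        rw [← NNReal.coe_lt_coe, coe_nnnorm, Real.coe_toNNReal ρ hρ.le]
        exact h z hz
    obtain ⟨s, hs1, hs2⟩ := ENNReal.lt_iff_exists_nnreal_btwn.mp h1
    have hs0 : 0 < s := by
      have : (0 : ENNReal) < s := lt_of_le_of_lt zero_le hs1
      exact_mod_cast this
    have hsρ : (s : ℝ) < ρ := by
      have : s < ρ.toNNReal := by exact_mod_cast hs2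
      rwa [← NNReal.coe_lt_coe, Real.coe_toNNReal ρ hρ.le] at this
    refine ⟨s, hs0, hsρ, ?_⟩
    have ht := spectrum.pow_nnnorm_pow_one_div_tendsto_nhds_spectralRadius a
    filter_upwards [ht.eventually (gt_mem_nhds hs1), eventually_gt_atTop 0] with n hn hn0
    have h2 : (‖a ^ n‖₊ : ENNReal) ≤ (s : ENNReal) ^ n := by
      have h3 := ENNReal.rpow_le_rpow hn.le (Nat.cast_nonneg n : (0 : ℝ) ≤ n)
      rw [← ENNReal.rpow_mul, one_div, inv_mul_cancel₀ (by positivity), ENNReal.rpow_one,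
        ENNReal.rpow_natCast] at h3
      exact h3
    have h4 : ‖a ^ n‖₊ ≤ s ^ n := by exact_mod_cast h2
    exact_mod_cast h4

open Polynomial in
theorem finrank_ker_aeval_prod_X_sub_C_pow {V : Type*} [AddCommGroup V] [Module ℂ V]
    (f : V →ₗ[ℂ] V) (S : Finset ℂ) (m : ℕ)
    (hfd : ∀ η ∈ S, FiniteDimensional ℂ (LinearMap.ker (aeval f ((X - C η) ^ m)))) :
    FiniteDimensional ℂ (LinearMap.ker (aeval f (∏ η ∈ S, (X - C η) ^ m))) ∧
    Module.finrank ℂ (LinearMap.ker (aeval f (∏ η ∈ S, (X - C η) ^ m))) =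
      ∑ η ∈ S, Module.finrank ℂ (LinearMap.ker (aeval f ((X - C η) ^ m))) := by
  classical
  induction S using Finset.induction_on with
  | empty =>
    have h : LinearMap.ker (aeval f (1 : ℂ[X])) = ⊥ := by
      rw [map_one]
      exact LinearMap.ker_id
    rw [Finset.prod_empty, Finset.sum_empty, h]
    exact ⟨inferInstance, finrank_bot ℂ V⟩
  | insert a S ha ih =>
    obtain ⟨ih1, ih2⟩ := ih fun η hη => hfd η (Finset.mem_insert_of_mem hη)
    have hfa := hfd a (Finset.mem_insert_self a S)
    have hcop : IsCoprime ((X - C a) ^ m) (∏ η ∈ S, (X - C η) ^ m) := by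
      apply IsCoprime.prod_right
      intro η hη
      apply IsCoprime.pow
      apply isCoprime_X_sub_C_of_isUnit_sub
      exact (sub_ne_zero_of_ne (by rintro rfl; exact ha hη)).isUnit
    rw [Finset.prod_insert ha, Finset.sum_insert ha,
      ← sup_ker_aeval_eq_ker_aeval_mul_of_coprime f hcop]
    refine ⟨inferInstance, ?_⟩
    rw [← ih2, ← Submodule.finrank_sup_add_finrank_inf_eq,
      (disjoint_ker_aeval_of_isCoprime f hcop).eq_bot, finrank_bot, add_zero]

/-! ### Spectrum, root spaces and Riesz projection of a compact operator -/

section Riesz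

variable {H : Type*} [NormedAddCommGroup H] [InnerProductSpace ℂ H] [CompleteSpace H]

theorem exists_apply_eq_smul_of_mem_spectrum {A : H →L[ℂ] H} (hA : IsCompactOperator A) {η : ℂ}
    (hη : η ≠ 0) (h : η ∈ spectrum ℂ A) : ∃ x, x ≠ 0 ∧ A x = η • x := by
  obtain ⟨x, hx⟩ := ((hA.hasEigenvalue_iff_mem_spectrum hη).mpr h).exists_hasEigenvector
  exact ⟨x, hx.2, hx.apply_eq_smul⟩

omit [CompleteSpace H] in
theorem hasEigenvector_of_apply_eq_smul {A : H →L[ℂ] H} {η : ℂ} {x : H} (hx : x ≠ 0)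
    (h : A x = η • x) : Module.End.HasEigenvector (A : H →ₗ[ℂ] H) η x :=
  ⟨Module.End.mem_eigenspace_iff.mpr h, hx⟩

theorem mem_spectrum_of_apply_eq_smul {A : H →L[ℂ] H} {η : ℂ} {x : H} (hx : x ≠ 0)
    (h : A x = η • x) : η ∈ spectrum ℂ A := by
  rw [ContinuousLinearMap.spectrum_eq]
  exact (Module.End.hasEigenvalue_of_hasEigenvector
    (hasEigenvector_of_apply_eq_smul hx h)).mem_spectrum

/-- Infinitely many such eigenvalues would give independent eigenvectors, whose successive spans
form a chain forbidden by `not_isCompactOperator_of_strictMono_chain`. -/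
theorem finite_spectrum_norm_ge {A : H →L[ℂ] H} (hA : IsCompactOperator A) {ρ : ℝ} (hρ : 0 < ρ) :
    {η : ℂ | η ∈ spectrum ℂ A ∧ ρ ≤ ‖η‖}.Finite := by
  by_contra hinf
  have hinf' : {η : ℂ | η ∈ spectrum ℂ A ∧ ρ ≤ ‖η‖}.Infinite := hinf
  let c := hinf'.natEmbedding
  have hc : ∀ n, ρ ≤ ‖(c n : ℂ)‖ := fun n => (c n).2.2
  have hex : ∀ n, ∃ x, x ≠ 0 ∧ A x = (c n : ℂ) • x := fun n =>
    exists_apply_eq_smul_of_mem_spectrum hA (norm_pos_iff.mp (hρ.trans_le (hc n))) (c n).2.1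
  choose e he0 he using hex
  have hli : LinearIndependent ℂ e :=
    Module.End.eigenvectors_linearIndependent' (A : H →ₗ[ℂ] H) (fun n => (c n : ℂ))
      (fun m n h => c.injective (Subtype.ext h)) e
      (fun n => hasEigenvector_of_apply_eq_smul (he0 n) (he n))
  let V : ℕ → Submodule ℂ H := fun n => Submodule.span ℂ (e '' Set.Iio n)
  have hV : StrictMono V := by
    apply strictMono_nat_of_lt_succ
    intro n
    apply lt_of_le_of_ne
    · exact Submodule.span_mono (Set.image_mono (Set.Iio_subset_Iio (Nat.le_succ n)))
    · intro h
      have h1 : e n ∈ V (n + 1) := Submodule.subset_span ⟨n, Nat.lt_succ_self n, rfl⟩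
      rw [← h] at h1
      exact hli.notMem_span_image (s := Set.Iio n) (x := n) (by simp) h1
  refine not_isCompactOperator_of_strictMono_chain hV (fun n => ?_) hρ hc (fun n x hx => ?_) hA
  · have : FiniteDimensional ℂ (V n) :=
      FiniteDimensional.span_of_finite ℂ ((Set.finite_Iio n).image e)
    exact (V n).closed_of_finiteDimensional
  · induction hx using Submodule.span_induction with
    | mem x hx =>
      obtain ⟨i, hi, rfl⟩ := hx
      rw [he, ← sub_smul]
      rcases (Nat.lt_succ_iff_lt_or_eq.mp hi) with h | rfl
      · exact Submodule.smul_mem _ _ (Submodule.subset_span ⟨i, h, rfl⟩)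
      · rw [sub_self, zero_smul]
        exact zero_mem _
    | zero => simp
    | add x y _ _ hx hy =>
      have := add_mem hx hy
      rw [map_add, smul_add]
      convert this using 1
      abel
    | smul a x _ hx =>
      have := Submodule.smul_mem _ a hx
      rw [map_smul, smul_comm, ← smul_sub]
      exact this

open Polynomial in
omit [CompleteSpace H] in
theorem isCompactOperator_aeval_sub {A : H →L[ℂ] H} (hA : IsCompactOperator A) (p : ℂ[X]) :
    IsCompactOperator (aeval A p - p.eval 0 • (1 : H →L[ℂ] H)) := by
  have h : aeval A p - p.eval 0 • (1 : H →L[ℂ] H) = aeval A p.divX * A := by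
    conv_lhs => rw [← p.divX_mul_X_add]
    simp [Algebra.algebraMap_eq_smul_one, coeff_zero_eq_eval_zero]
  rw [h]
  exact hA.clm_comp (aeval A p.divX)

open Polynomial in
omit [CompleteSpace H] in
theorem toLinearMap_aeval (A : H →L[ℂ] H) (p : ℂ[X]) :
    (aeval A p).toLinearMap = aeval (A : H →ₗ[ℂ] H) p := by
  induction p using Polynomial.induction_on' with
  | add p q hp hq => rw [map_add, map_add, ContinuousLinearMap.toLinearMap_add, hp, hq]
  | monomial n a =>
    ext x
    simp [aeval_monomial, Algebra.algebraMap_eq_smul_one, ← ContinuousLinearMap.toLinearMap_pow]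

theorem rootSpace_eq_ker_pow {A : H →L[ℂ] H} (hA : IsCompactOperator A) {η : ℂ} (hη : η ≠ 0) :
    ∃ k, ∀ m, k ≤ m → rootSpace A η =
      LinearMap.ker ((A - η • (1 : H →L[ℂ] H)).toLinearMap ^ m) := by
  have hT : IsCompactOperator ((A - η • (1 : H →L[ℂ] H)) - (-η) • (1 : H →L[ℂ] H)) := by
    simpa using hA
  obtain ⟨k, hk⟩ := exists_ker_pow_eq_of_isCompactOperator_sub (neg_ne_zero.mpr hη) hT
  have hmem : ∀ x, x ∈ rootSpace A η ↔ ∃ j : ℕ, ((A - η • (1 : H →L[ℂ] H)).toLinearMap ^ j) x = 0 :=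
    fun x => Module.End.mem_maxGenEigenspace _ _ _
  refine ⟨k, fun m hm => ?_⟩
  ext x
  rw [hmem]
  refine ⟨fun ⟨j, hj⟩ => ?_, fun h => ⟨m, h⟩⟩
  rw [hk m hm, ← hk (max j k) (le_max_right _ _), LinearMap.mem_ker,
    ← Nat.sub_add_cancel (le_max_left j k), pow_add, Module.End.mul_apply, hj, map_zero]

-- Take T = p(A)^m, where p has the spectral points with |η| ≥ ρ as simple roots. Since p(0) ≠ 0, T
-- is a nonzero scalar plus a compact operator, and for large m its kernel is the direct sum of the
-- root spaces at these points. The last two clauses say which eigenvalues live on the kernel and on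
-- the range of the projection.
open Polynomial in
theorem exists_riesz_projection {A : H →L[ℂ] H} (hA : IsCompactOperator A) {ρ : ℝ} (hρ : 0 < ρ) :
    ∃ Pr : H →L[ℂ] H, (∀ x, Pr (A x) = A (Pr x)) ∧ (∀ x, Pr (Pr x) = Pr x) ∧
      FiniteDimensional ℂ (LinearMap.range Pr.toLinearMap) ∧
      (∀ η ∈ spectrum ℂ A, ρ ≤ ‖η‖ → FiniteDimensional ℂ (rootSpace A η)) ∧
      Module.finrank ℂ (LinearMap.range Pr.toLinearMap) =
        ∑ η ∈ (finite_spectrum_norm_ge hA hρ).toFinset, algMultiplicity A η ∧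
      (∀ (η : ℂ) (x : H), A x = η • x → x ≠ 0 → Pr x = 0 → ‖η‖ < ρ) ∧
      (∀ (η : ℂ) (x : H), A x = η • x → x ≠ 0 → Pr x = x → ρ ≤ ‖η‖) := by
  set S := (finite_spectrum_norm_ge hA hρ).toFinset with hS
  have hmemS : ∀ η, η ∈ S ↔ η ∈ spectrum ℂ A ∧ ρ ≤ ‖η‖ := fun η => by simp [hS]
  have hS0 : ∀ η ∈ S, η ≠ 0 := fun η hη => norm_pos_iff.mp (hρ.trans_le ((hmemS η).mp hη).2)
  have hk : ∀ η ∈ S, ∃ k, ∀ m, k ≤ m → rootSpace A η =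
      LinearMap.ker ((A - η • (1 : H →L[ℂ] H)).toLinearMap ^ m) :=
    fun η hη => rootSpace_eq_ker_pow hA (hS0 η hη)
  choose! k hk using hk
  set p : ℂ[X] := ∏ η ∈ S, (X - C η) with hp
  have hp0 : p.eval 0 ≠ 0 := by
    rw [hp, eval_prod, Finset.prod_ne_zero_iff]
    intro η hη
    simpa using hS0 η hη
  obtain ⟨kp, hkp⟩ := exists_ker_pow_eq_of_isCompactOperator_sub hp0
    (isCompactOperator_aeval_sub hA p)
  -- Beyond `kp`, ker T² = ker T; beyond every `k η`, the root spaces are reached; m ≥ 1 makes p^m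
  -- vanish on `S`.
  set m := max (max kp 1) (S.sup k) with hm
  have hm1 : m ≠ 0 := by
    have : 1 ≤ m := (le_max_right _ _).trans (le_max_left _ _)
    omega
  have hkpm : kp ≤ m := (le_max_left _ _).trans (le_max_left _ _)
  set T : H →L[ℂ] H := aeval A (p ^ m) with hT
  have hTeq : T.toLinearMap = (aeval A p).toLinearMap ^ m := by
    rw [hT, map_pow, ContinuousLinearMap.toLinearMap_pow]
  have hTker : ∀ x, T (T x) = 0 → T x = 0 := by
    intro x hx
    have h1 : x ∈ LinearMap.ker ((aeval A p).toLinearMap ^ (m + m)) := by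
      rw [pow_add, ← hTeq]
      exact hx
    rw [hkp _ (hkpm.trans (Nat.le_add_right m m)), ← hkp m hkpm, ← hTeq] at h1
    exact h1
  have hc : (p ^ m).eval 0 ≠ 0 := by rw [eval_pow]; exact pow_ne_zero _ hp0
  have hTc := isCompactOperator_aeval_sub hA (p ^ m)
  have hTA : ∀ x, T (A x) = A (T x) := fun x => by
    have h : Commute T A := by
      have := (aeval_X (R := ℂ) A)
      rw [hT]
      conv_rhs => rw [← this]
      exact (Commute.all (p ^ m) X).map (aeval A)
    exact congrArg (fun f : H →L[ℂ] H => f x) h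
  obtain ⟨Pr, h1, h2, h3, h4⟩ := exists_projection_ker_range hc hTc hTker
  have hrange : LinearMap.range Pr.toLinearMap =
      LinearMap.ker (aeval (A : H →ₗ[ℂ] H) (∏ η ∈ S, (X - C η) ^ m)) := by
    rw [Finset.prod_pow, ← toLinearMap_aeval]
    ext x
    constructor
    · rintro ⟨y, rfl⟩
      exact h1 y
    · exact fun hx => ⟨x, h2 x hx⟩
  have hroot : ∀ η ∈ S, rootSpace A η =
      LinearMap.ker (aeval (A : H →ₗ[ℂ] H) ((X - C η) ^ m)) := by
    intro η hη
    rw [hk η hη m ((Finset.le_sup hη).trans (le_max_right _ _)), map_pow, ← toLinearMap_aeval]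
    simp [Algebra.algebraMap_eq_smul_one]
  have heig : ∀ (η : ℂ) (x : H), A x = η • x → T x = (p ^ m).eval η • x := by
    intro η x hx
    by_cases hx0 : x = 0
    · simp [hx0]
    · have := Module.End.aeval_apply_of_hasEigenvector (p := p ^ m)
        (hasEigenvector_of_apply_eq_smul hx0 hx)
      rw [← toLinearMap_aeval] at this
      exact this
  have hfd : ∀ η ∈ S, FiniteDimensional ℂ (rootSpace A η) := by
    intro η hη
    have hfT := finiteDimensional_ker_of_isCompactOperator_sub hc hTc
    rw [hroot η hη]
    refine Submodule.finiteDimensional_of_le (S₂ := LinearMap.ker T.toLinearMap) ?_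
    rw [hT, toLinearMap_aeval]
    obtain ⟨q, hq⟩ := pow_dvd_pow_of_dvd (Finset.dvd_prod_of_mem (fun η => X - C η) hη) m
    intro x hx
    rw [LinearMap.mem_ker] at hx ⊢
    rw [hp, hq, mul_comm, map_mul, Module.End.mul_apply, hx, map_zero]
  have hfr := finrank_ker_aeval_prod_X_sub_C_pow (A : H →ₗ[ℂ] H) S m
    (fun η hη => hroot η hη ▸ hfd η hη)
  refine ⟨Pr, fun x => ?_, fun x => h2 _ (h1 x), ?_, fun η hη hη' => hfd η ((hmemS η).mpr ⟨hη, hη'⟩),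
    ?_, fun η x hx hx0 hPx => ?_, fun η x hx hx0 hPx => ?_⟩
  · obtain ⟨z, hz⟩ := h3 x
    have hx : x = Pr x + T z := by rw [← hz]; abel
    conv_lhs => rw [hx, map_add, ← hTA, map_add, h4, add_zero]
    exact h2 _ (by rw [hTA, h1, map_zero])
  · rw [hrange]
    exact hfr.1
  · rw [hrange, hfr.2]
    refine Finset.sum_congr rfl fun η hη => ?_
    rw [algMultiplicity, hroot η hη]
  · by_contra hcon
    apply hx0
    have hηS : η ∈ S := (hmemS η).mpr ⟨mem_spectrum_of_apply_eq_smul hx0 hx, not_lt.mp hcon⟩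
    have hpη : (p ^ m).eval η = 0 := by
      rw [eval_pow, hp, eval_prod, Finset.prod_eq_zero hηS (by simp), zero_pow hm1]
    rw [← hPx, h2 x (by rw [heig η x hx, hpη, zero_smul])]
  · have hTx : T x = 0 := by rw [← hPx, h1]
    rw [heig η x hx, smul_eq_zero, or_iff_left hx0, eval_pow, hp, eval_prod] at hTx
    obtain ⟨ξ, hξ, hξ'⟩ := Finset.prod_eq_zero_iff.mp (eq_zero_of_pow_eq_zero hTx)
    have : η = ξ := by simpa [sub_eq_zero] using hξ'
    rw [this]
    exact ((hmemS ξ).mp hξ).2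

end Riesz

/-! ### Growth of orbits and the filtration by slow spaces -/

theorem eventually_norm_pow_apply_le_of_spectrum_lt {E : Type*} [NormedAddCommGroup E]
    [NormedSpace ℂ E] [CompleteSpace E] (a : E →L[ℂ] E) {ρ : ℝ} (hρ : 0 < ρ)
    (h : ∀ z ∈ spectrum ℂ a, ‖z‖ < ρ) :
    ∃ s, 0 < s ∧ s < ρ ∧ ∀ᶠ n : ℕ in atTop, ∀ x, ‖(a ^ n) x‖ ≤ s ^ n * ‖x‖ := by
  obtain ⟨s, hs0, hsρ, hs⟩ := eventually_norm_pow_le_of_spectrum_lt a hρ h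
  exact ⟨s, hs0, hsρ, hs.mono fun n hn x => (a ^ n).le_of_opNorm_le hn x⟩

/-- This is the upper growth bound applied to the inverse of a, whose spectrum lies in the open disc
of radius 1/c. -/
theorem eventually_le_norm_pow_apply_of_spectrum_ge {E : Type*} [NormedAddCommGroup E]
    [NormedSpace ℂ E] [CompleteSpace E] (a : E →L[ℂ] E) {ρ c : ℝ} (hc : 0 < c) (hcρ : c < ρ)
    (h : ∀ z ∈ spectrum ℂ a, ρ ≤ ‖z‖) :
    ∀ᶠ n : ℕ in atTop, ∀ x, c ^ n * ‖x‖ ≤ ‖(a ^ n) x‖ := by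
  have hu : IsUnit a := by
    rw [← spectrum.zero_notMem_iff ℂ]
    intro h0
    have := h 0 h0
    rw [norm_zero] at this
    linarith
  obtain ⟨u, hu⟩ := hu
  have hsp' : ∀ z ∈ spectrum ℂ (↑u⁻¹ : E →L[ℂ] E), ‖z‖ < c⁻¹ := by
    intro z hz
    rw [← spectrum.map_inv, Set.mem_inv, hu] at hz
    have h1 := h _ hz
    rw [norm_inv] at h1
    have hz0 : 0 < ‖z‖ := by
      rw [← inv_pos]
      linarith
    rw [lt_inv_comm₀ hz0 hc]
    linarith
  obtain ⟨s, hs0, hsc, hs⟩ :=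
    eventually_norm_pow_apply_le_of_spectrum_lt _ (inv_pos.mpr hc) hsp'
  refine hs.mono fun n hn x => ?_
  have h1 := hn ((a ^ n) x)
  have h2 : ((↑u⁻¹ : E →L[ℂ] E) ^ n) ((a ^ n) x) = x := by
    have : (↑u⁻¹ : E →L[ℂ] E) ^ n * a ^ n = 1 := by
      rw [← hu, ← Units.val_pow_eq_pow_val, ← Units.val_pow_eq_pow_val, ← Units.val_mul, inv_pow,
        inv_mul_cancel, Units.val_one]
    exact congrArg (fun f : E →L[ℂ] E => f x) this
  rw [h2] at h1
  have hcs : c * s ≤ 1 := by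
    have := mul_le_mul_of_nonneg_left hsc.le hc.le
    rwa [mul_inv_cancel₀ hc.ne'] at this
  calc c ^ n * ‖x‖ ≤ c ^ n * (s ^ n * ‖(a ^ n) x‖) := by gcongr
    _ = (c * s) ^ n * ‖(a ^ n) x‖ := by rw [mul_pow]; ring
    _ ≤ 1 * ‖(a ^ n) x‖ := by
      gcongr
      exact pow_le_one₀ (by positivity) hcs
    _ = _ := one_mul _

section Growth

variable {H : Type*} [NormedAddCommGroup H] [InnerProductSpace ℂ H]

/-- The restriction of a continuous linear endomorphism to an invariant subspace. -/
def restrictInvariant (A : H →L[ℂ] H) (W : Submodule ℂ H) (hW : ∀ x ∈ W, A x ∈ W) : W →L[ℂ] W :=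
  (A.comp W.subtypeL).codRestrict W fun x => hW x x.2

theorem restrictInvariant_pow_apply (A : H →L[ℂ] H) (W : Submodule ℂ H) (hW : ∀ x ∈ W, A x ∈ W)
    (n : ℕ) (x : W) : ((restrictInvariant A W hW ^ n) x : H) = (A ^ n) x := by
  induction n with
  | zero => rfl
  | succ n ih =>
    rw [pow_succ', pow_succ', mul_apply_eq_comp, mul_apply_eq_comp, ← ih]
    rfl

theorem eventually_norm_pow_apply_le [CompleteSpace H] {A : H →L[ℂ] H} (hA : IsCompactOperator A)
    {ρ : ℝ} (hρ : 0 < ρ) {W : Submodule ℂ H} (hWc : IsClosed (W : Set H))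
    (hW : ∀ x ∈ W, A x ∈ W)
    (heig : ∀ (η : ℂ) (x : H), A x = η • x → x ≠ 0 → x ∈ W → ‖η‖ < ρ) :
    ∃ s, 0 < s ∧ s < ρ ∧ ∀ᶠ n : ℕ in atTop, ∀ x ∈ W, ‖(A ^ n) x‖ ≤ s ^ n * ‖x‖ := by
  have : CompleteSpace W := hWc.completeSpace_coe
  have hc : IsCompactOperator (restrictInvariant A W hW) :=
    (hA.comp_clm W.subtypeL).codRestrict (fun x => hW x x.2) hWc
  have hsp : ∀ z ∈ spectrum ℂ (restrictInvariant A W hW), ‖z‖ < ρ := by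
    intro z hz
    by_cases hz0 : z = 0
    · rwa [hz0, norm_zero]
    · obtain ⟨x, hx⟩ := ((hc.hasEigenvalue_iff_mem_spectrum hz0).mpr hz).exists_hasEigenvector
      have h := congrArg (Subtype.val) hx.apply_eq_smul
      exact heig z x h (fun h0 => hx.2 (Subtype.ext h0)) x.2
  obtain ⟨s, hs0, hsρ, hs⟩ := eventually_norm_pow_apply_le_of_spectrum_lt _ hρ hsp
  refine ⟨s, hs0, hsρ, hs.mono fun n hn x hx => ?_⟩
  rw [← restrictInvariant_pow_apply A W hW n ⟨x, hx⟩]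
  exact hn ⟨x, hx⟩

theorem eventually_le_norm_pow_apply {A : H →L[ℂ] H}
    {ρ : ℝ} {W : Submodule ℂ H} [FiniteDimensional ℂ W]
    (hW : ∀ x ∈ W, A x ∈ W)
    (heig : ∀ (η : ℂ) (x : H), A x = η • x → x ≠ 0 → x ∈ W → ρ ≤ ‖η‖) {c : ℝ} (hc : 0 < c)
    (hcρ : c < ρ) :
    ∀ᶠ n : ℕ in atTop, ∀ x ∈ W, c ^ n * ‖x‖ ≤ ‖(A ^ n) x‖ := by
  have : CompleteSpace W := FiniteDimensional.complete ℂ W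
  set a := restrictInvariant A W hW with ha
  have hsp : ∀ z ∈ spectrum ℂ a, ρ ≤ ‖z‖ := by
    intro z hz
    rw [ContinuousLinearMap.spectrum_eq, ← Module.End.hasEigenvalue_iff_mem_spectrum] at hz
    obtain ⟨x, hx⟩ := hz.exists_hasEigenvector
    have h := congrArg (Subtype.val) hx.apply_eq_smul
    exact heig z x h (fun h0 => hx.2 (Subtype.ext h0)) x.2
  refine (eventually_le_norm_pow_apply_of_spectrum_ge a hc hcρ hsp).mono fun n hn x hx => ?_
  rw [← restrictInvariant_pow_apply A W hW n ⟨x, hx⟩]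
  exact hn ⟨x, hx⟩

/-- The vectors whose orbit under `A` is `O(sⁿ)` for some `s < ρ`. -/
def slowSpace (A : H →L[ℂ] H) (ρ : ℝ) : Submodule ℂ H where
  -- The extra zero keeps this a subspace when ρ ≤ 0, where no s exists.
  carrier := {x | ∃ s, 0 < s ∧ s < ρ ∧ ∃ C, ∀ᶠ n : ℕ in atTop, ‖(A ^ n) x‖ ≤ C * s ^ n} ∪ {0}
  zero_mem' := Or.inr rfl
  add_mem' := by
    rintro x y (⟨s, hs0, hsρ, C, hC⟩ | rfl) (⟨t, ht0, htρ, D, hD⟩ | rfl)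
    · refine Or.inl ⟨max s t, lt_max_of_lt_left hs0, max_lt hsρ htρ, |C| + |D|, ?_⟩
      filter_upwards [hC, hD] with n hn hn'
      rw [map_add]
      have h1 : s ^ n ≤ max s t ^ n := pow_le_pow_left₀ hs0.le (le_max_left _ _) n
      have h2 : t ^ n ≤ max s t ^ n := pow_le_pow_left₀ ht0.le (le_max_right _ _) n
      have h3 : C * s ^ n ≤ |C| * max s t ^ n :=
        mul_le_mul (le_abs_self C) h1 (by positivity) (abs_nonneg C)
      have h4 : D * t ^ n ≤ |D| * max s t ^ n :=
        mul_le_mul (le_abs_self D) h2 (by positivity) (abs_nonneg D)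
      linarith [norm_add_le ((A ^ n) x) ((A ^ n) y)]
    · rw [add_zero]
      exact Or.inl ⟨s, hs0, hsρ, C, hC⟩
    · rw [zero_add]
      exact Or.inl ⟨t, ht0, htρ, D, hD⟩
    · exact Or.inr (add_zero _)
  smul_mem' := by
    rintro a x (⟨s, hs0, hsρ, C, hC⟩ | rfl)
    · refine Or.inl ⟨s, hs0, hsρ, ‖a‖ * C, hC.mono fun n hn => ?_⟩
      rw [map_smul, norm_smul, mul_assoc]
      gcongr
    · exact Or.inr (smul_zero a)

theorem mem_slowSpace {A : H →L[ℂ] H} {ρ : ℝ} (hρ : 0 < ρ) {x : H} : x ∈ slowSpace A ρ ↔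
    ∃ s, 0 < s ∧ s < ρ ∧ ∃ C, ∀ᶠ n : ℕ in atTop, ‖(A ^ n) x‖ ≤ C * s ^ n := by
  refine ⟨?_, Or.inl⟩
  rintro (h | rfl)
  · exact h
  · exact ⟨ρ / 2, by positivity, by linarith, 0, Eventually.of_forall fun n => by simp⟩

theorem slowSpace_mono (A : H →L[ℂ] H) : Monotone (slowSpace A) := by
  rintro ρ r hr x (⟨s, hs0, hs, h⟩ | h)
  · exact Or.inl ⟨s, hs0, hs.trans_le hr, h⟩
  · exact Or.inr h

theorem eq_zero_of_mem_slowSpace {A : H →L[ℂ] H} {ρ : ℝ} {x : H} (hx : x ∈ slowSpace A ρ)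
    (h : ∀ c, 0 < c → c < ρ → ∃ δ > 0, ∀ᶠ n : ℕ in atTop, c ^ n * δ * ‖x‖ ≤ ‖(A ^ n) x‖) :
    x = 0 := by
  rcases hx with ⟨s, hs0, hsρ, C, hC⟩ | h
  · by_contra hx0
    obtain ⟨c, hsc, hcρ⟩ := exists_between hsρ
    have hc0 := hs0.trans hsc
    obtain ⟨δ, hδ, hδ'⟩ := h c hc0 hcρ
    have hxn : 0 < ‖x‖ := norm_pos_iff.mpr hx0
    have ht : Tendsto (fun n : ℕ => C * (s / c) ^ n) atTop (𝓝 (C * 0)) :=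
      (tendsto_pow_atTop_nhds_zero_of_lt_one (by positivity) ((div_lt_one hc0).mpr hsc)).const_mul C
    rw [mul_zero] at ht
    obtain ⟨n, h1, h2, h3⟩ := (hC.and (hδ'.and (ht.eventually (gt_mem_nhds
      (show 0 < δ * ‖x‖ by positivity))))).exists
    have hcn : 0 < c ^ n := pow_pos hc0 n
    rw [div_pow, mul_div_assoc', div_lt_iff₀ hcn] at h3
    linarith
  · exact h

/-- A slow vector has a slow component in the range of the projection, where orbits grow at least
like cⁿ for every c < ρ; so that component vanishes. This describes the kernel by growth alone, and
makes the bound on it uniform. -/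
theorem exists_projection_slowSpace [CompleteSpace H] {A : H →L[ℂ] H} (hA : IsCompactOperator A)
    {ρ : ℝ} (hρ : 0 < ρ) :
    ∃ Pr : H →L[ℂ] H, (∀ x, Pr (A x) = A (Pr x)) ∧ (∀ x, Pr (Pr x) = Pr x) ∧
      FiniteDimensional ℂ (LinearMap.range Pr.toLinearMap) ∧
      (∀ η ∈ spectrum ℂ A, ρ ≤ ‖η‖ → FiniteDimensional ℂ (rootSpace A η)) ∧
      Module.finrank ℂ (LinearMap.range Pr.toLinearMap) =
        ∑ η ∈ (finite_spectrum_norm_ge hA hρ).toFinset, algMultiplicity A η ∧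
      LinearMap.ker Pr.toLinearMap = slowSpace A ρ ∧
      (∃ s, 0 < s ∧ s < ρ ∧ ∀ᶠ n : ℕ in atTop, ∀ x ∈ slowSpace A ρ, ‖(A ^ n) x‖ ≤ s ^ n * ‖x‖) ∧
      ∀ c, 0 < c → c < ρ → ∀ᶠ n : ℕ in atTop, ∀ x, c ^ n * ‖Pr x‖ ≤ ‖(A ^ n) (Pr x)‖ := by
  obtain ⟨Pr, hcomm, hidem, hfd, hroot, hrank, hker, hran⟩ := exists_riesz_projection hA hρ
  obtain ⟨s, hs0, hsρ, hs⟩ := eventually_norm_pow_apply_le hA hρ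
    (W := LinearMap.ker Pr.toLinearMap) Pr.isClosed_ker
    (fun x (hx : Pr x = 0) => show Pr (A x) = 0 by rw [hcomm, hx, map_zero])
    (fun η x hx hx0 hxW => hker η x hx hx0 hxW)
  have hlow : ∀ c, 0 < c → c < ρ → ∀ᶠ n : ℕ in atTop, ∀ x, c ^ n * ‖Pr x‖ ≤ ‖(A ^ n) (Pr x)‖ := by
    intro c hc hcρ
    refine (eventually_le_norm_pow_apply (A := A) (W := LinearMap.range Pr.toLinearMap)
      ?_ ?_ hc hcρ).mono fun n hn x => hn _ ⟨x, rfl⟩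
    · rintro _ ⟨y, rfl⟩
      exact ⟨A y, hcomm y⟩
    · rintro η _ hx hx0 ⟨y, rfl⟩
      exact hran η _ hx hx0 (hidem y)
  have heq : LinearMap.ker Pr.toLinearMap = slowSpace A ρ := by
    apply le_antisymm
    · intro x hx
      exact Or.inl ⟨s, hs0, hsρ, ‖x‖, hs.mono fun n hn => (hn x hx).trans_eq (mul_comm _ _)⟩
    · intro x hx
      have hw : x - Pr x ∈ LinearMap.ker Pr.toLinearMap :=
        show Pr (x - Pr x) = 0 by rw [map_sub, hidem, sub_self]
      have hw' : x - Pr x ∈ slowSpace A ρ :=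
        Or.inl ⟨s, hs0, hsρ, ‖x - Pr x‖, hs.mono fun n hn => (hn _ hw).trans_eq (mul_comm _ _)⟩
      have hp : Pr x ∈ slowSpace A ρ := by simpa using sub_mem hx hw'
      exact eq_zero_of_mem_slowSpace hp fun c hc hcρ =>
        ⟨1, one_pos, (hlow c hc hcρ).mono fun n hn => by rw [mul_one]; exact hn x⟩
  exact ⟨Pr, hcomm, hidem, hfd, hroot, hrank, heq, ⟨s, hs0, hsρ, heq ▸ hs⟩, hlow⟩

theorem isClosed_slowSpace [CompleteSpace H] {A : H →L[ℂ] H} (hA : IsCompactOperator A)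
    {ρ : ℝ} (hρ : 0 < ρ) : IsClosed (slowSpace A ρ : Set H) := by
  obtain ⟨Pr, -, -, -, -, -, heq, -⟩ := exists_projection_slowSpace hA hρ
  rw [← heq]
  exact Pr.isClosed_ker

/-- The orthogonal complement and the range of the oblique projection are both isomorphic to the
quotient by the slow space. -/
theorem finrank_orthogonal_slowSpace [CompleteSpace H] {A : H →L[ℂ] H} (hA : IsCompactOperator A)
    {ρ : ℝ} (hρ : 0 < ρ) : FiniteDimensional ℂ (slowSpace A ρ)ᗮ ∧
      Module.finrank ℂ (slowSpace A ρ)ᗮ =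
        ∑ η ∈ (finite_spectrum_norm_ge hA hρ).toFinset, algMultiplicity A η := by
  obtain ⟨Pr, -, hidem, hfd, -, hrank, heq, -⟩ := exists_projection_slowSpace hA hρ
  have : CompleteSpace (slowSpace A ρ) := (isClosed_slowSpace hA hρ).completeSpace_coe
  have h1 : IsCompl (slowSpace A ρ) (slowSpace A ρ)ᗮ := Submodule.isCompl_orthogonal _
  have e1 := Submodule.quotientEquivOfIsCompl _ _ h1
  have e2 := Pr.toLinearMap.quotKerEquivRange
  rw [heq] at e2
  have e := e1.symm.trans e2
  exact ⟨e.symm.finiteDimensional, by rw [e.finrank_eq, hrank]⟩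

end Growth

/-! ### Operator inequalities for |Aⁿ|^{1/n} -/

section Loewner

variable {H : Type*} [NormedAddCommGroup H] [InnerProductSpace ℂ H] [CompleteSpace H]

omit [CompleteSpace H] in
theorem re_inner_le_of_le {S T : H →L[ℂ] H} (h : S ≤ T) (x : H) :
    (inner ℂ (S x) x).re ≤ (inner ℂ (T x) x).re := by
  have h1 := ((ContinuousLinearMap.le_def S T).mp h).re_inner_nonneg_left x
  rw [sub_apply, inner_sub_left] at h1
  simpa using h1

theorem le_of_re_inner_le {S T : H →L[ℂ] H} (hS : IsSelfAdjoint S) (hT : IsSelfAdjoint T)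
    (h : ∀ x, (inner ℂ (S x) x).re ≤ (inner ℂ (T x) x).re) : S ≤ T := by
  rw [ContinuousLinearMap.le_def, ContinuousLinearMap.isPositive_def']
  refine ⟨hT.sub hS, fun x => ?_⟩
  rw [ContinuousLinearMap.reApplyInnerSelf_apply, sub_apply, inner_sub_left]
  simpa using h x

theorem re_inner_star_mul_self (T : H →L[ℂ] H) (x : H) :
    (inner ℂ ((star T * T) x) x).re = ‖T x‖ ^ 2 :=
  (ContinuousLinearMap.apply_norm_sq_eq_inner_adjoint_left T x).symm

theorem absPowRoot_eq_rpow (A : H →L[ℂ] H) {n : ℕ} (hn : 0 < n) :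
    absPowRoot A n = (star (A ^ n) * A ^ n) ^ ((((2 * n : ℕ) : ℝ))⁻¹) := by
  rw [absPowRoot, CFC.abs, CFC.sqrt_eq_rpow, CFC.rpow_rpow_of_exponent_nonneg _ _ _ (by positivity)
    (by positivity) (star_mul_self_nonneg _)]
  congr 1
  push_cast
  field_simp

theorem pow_rpow_inv {X : H →L[ℂ] H} (hX : 0 ≤ X) {m : ℕ} (hm : 0 < m) :
    (X ^ m) ^ ((m : ℝ)⁻¹) = X := by
  rw [← CFC.rpow_natCast X m, CFC.rpow_rpow_of_exponent_nonneg _ _ _ (by positivity)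
    (by positivity) hX, mul_inv_cancel₀ (by positivity), CFC.rpow_one X hX]

theorem inv_natCast_mem_Icc {m : ℕ} (hm : 0 < m) : ((m : ℝ)⁻¹) ∈ Set.Icc (0 : ℝ) 1 :=
  ⟨by positivity, inv_le_one_of_one_le₀ (by exact_mod_cast hm)⟩

/-- Löwner–Heinz: t ↦ t^{1/(2n)} is operator monotone because its exponent lies in [0, 1]. -/
theorem le_absPowRoot {A X : H →L[ℂ] H} (hX : 0 ≤ X) {n : ℕ} (hn : 0 < n)
    (h : X ^ (2 * n) ≤ star (A ^ n) * A ^ n) : X ≤ absPowRoot A n := by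
  have hm : 0 < 2 * n := by omega
  have h1 := CFC.rpow_le_rpow (inv_natCast_mem_Icc hm) h
  rwa [pow_rpow_inv hX hm, ← absPowRoot_eq_rpow A hn] at h1

theorem absPowRoot_le {A X : H →L[ℂ] H} (hX : 0 ≤ X) {n : ℕ} (hn : 0 < n)
    (h : star (A ^ n) * A ^ n ≤ X ^ (2 * n)) : absPowRoot A n ≤ X := by
  have hm : 0 < 2 * n := by omega
  have h1 := CFC.rpow_le_rpow (inv_natCast_mem_Icc hm) h
  rwa [pow_rpow_inv hX hm, ← absPowRoot_eq_rpow A hn] at h1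

/-- The operator acting as `b` on the closed subspace `F` and as `a` on its complement. -/
noncomputable def blockOp (F : Submodule ℂ H) [F.HasOrthogonalProjection] (a b : ℝ) : H →L[ℂ] H :=
  (a : ℂ) • (1 - F.starProjection) + (b : ℂ) • F.starProjection

variable (F : Submodule ℂ H) [F.HasOrthogonalProjection]

omit [CompleteSpace H] in
theorem blockOp_pow (a b : ℝ) (m : ℕ) : blockOp F a b ^ m = blockOp F (a ^ m) (b ^ m) := by
  have hQ : F.starProjection * F.starProjection = F.starProjection :=
    F.isIdempotentElem_starProjection
  induction m with
  | zero => simp [blockOp]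
  | succ m ih =>
    rw [pow_succ, ih]
    simp only [blockOp, add_mul, mul_add, smul_mul_smul_comm, sub_mul, mul_sub, one_mul, mul_one,
      hQ, sub_self, sub_zero, smul_zero, add_zero, zero_add, pow_succ, Complex.ofReal_mul]

theorem isSelfAdjoint_blockOp (a b : ℝ) : IsSelfAdjoint (blockOp F a b) := by
  have hQ : IsSelfAdjoint F.starProjection := isSelfAdjoint_starProjection F
  have ha : IsSelfAdjoint (a : ℂ) := Complex.conj_ofReal a
  have hb : IsSelfAdjoint (b : ℂ) := Complex.conj_ofReal b
  exact (ha.smul ((IsSelfAdjoint.one _).sub hQ)).add (hb.smul hQ)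

omit [CompleteSpace H] in
theorem re_inner_blockOp (a b : ℝ) (x : H) :
    (inner ℂ (blockOp F a b x) x).re =
      a * ‖x - F.starProjection x‖ ^ 2 + b * ‖F.starProjection x‖ ^ 2 := by
  set y := F.starProjection x with hy
  have hyF : y ∈ F := F.starProjection_apply_mem x
  have h0 : inner ℂ (x - y) y = 0 := F.starProjection_inner_eq_zero x y hyF
  have h0' : inner ℂ y (x - y) = 0 := inner_eq_zero_symm.mp h0
  have h1 : blockOp F a b x = (a : ℂ) • (x - y) + (b : ℂ) • y := rfl
  have h2 : x = (x - y) + y := by abel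
  rw [h1]
  conv_lhs => rw [h2]
  simp only [add_sub_cancel_right, inner_add_left, inner_add_right, inner_smul_left, h0, h0',
    mul_zero, add_zero, zero_add, Complex.conj_ofReal, inner_self_eq_norm_sq_to_K]
  simp only [Complex.add_re, Complex.re_ofReal_mul]
  norm_cast

theorem blockOp_nonneg {a b : ℝ} (ha : 0 ≤ a) (hb : 0 ≤ b) : 0 ≤ blockOp F a b := by
  apply le_of_re_inner_le (IsSelfAdjoint.zero _) (isSelfAdjoint_blockOp F a b)
  intro x
  rw [re_inner_blockOp]
  simp only [zero_apply, inner_zero_left, Complex.zero_re]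
  positivity

variable {F}

theorem le_norm_pow_imp_blockOp_le {A : H →L[ℂ] H} {n : ℕ} (hn : 0 < n) {b : ℝ} (hb : 0 ≤ b)
    (h : ∀ x, b ^ n * ‖F.starProjection x‖ ≤ ‖(A ^ n) x‖) : blockOp F 0 b ≤ absPowRoot A n := by
  apply le_absPowRoot (blockOp_nonneg F le_rfl hb) hn
  rw [blockOp_pow]
  apply le_of_re_inner_le (isSelfAdjoint_blockOp _ _ _) (IsSelfAdjoint.star_mul_self _)
  intro x
  rw [re_inner_blockOp, re_inner_star_mul_self, zero_pow (by omega), zero_mul, zero_add]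
  have := pow_le_pow_left₀ (by positivity) (h x) 2
  calc b ^ (2 * n) * ‖F.starProjection x‖ ^ 2 = (b ^ n * ‖F.starProjection x‖) ^ 2 := by ring
    _ ≤ _ := this

theorem norm_pow_le_imp_le_blockOp {A : H →L[ℂ] H} {n : ℕ} (hn : 0 < n) {a b : ℝ} (ha : 0 ≤ a)
    (hb : 0 ≤ b) (h : ∀ x, ‖(A ^ n) x‖ ^ 2 ≤
      a ^ (2 * n) * ‖x - F.starProjection x‖ ^ 2 + b ^ (2 * n) * ‖F.starProjection x‖ ^ 2) :
    absPowRoot A n ≤ blockOp F a b := by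
  apply absPowRoot_le (blockOp_nonneg F ha hb) hn
  rw [blockOp_pow]
  apply le_of_re_inner_le (IsSelfAdjoint.star_mul_self _) (isSelfAdjoint_blockOp _ _ _)
  intro x
  rw [re_inner_blockOp, re_inner_star_mul_self]
  exact h x

end Loewner

/-! ### Quadratic form bounds for a limit point -/

section LimitPoint

variable {H : Type*} [NormedAddCommGroup H] [InnerProductSpace ℂ H] [CompleteSpace H]
  {A B : H →L[ℂ] H}

theorem tendsto_re_inner {φ : ℕ → ℕ} (h : Tendsto (fun k => absPowRoot A (φ k)) atTop (𝓝 B))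
    (x : H) :
    Tendsto (fun k => (inner ℂ (absPowRoot A (φ k) x) x).re) atTop (𝓝 (inner ℂ (B x) x).re) := by
  have hc : Continuous fun T : H →L[ℂ] H => (inner ℂ (T x) x).re := by fun_prop
  exact (hc.tendsto B).comp h

theorem le_re_inner_of_mem_normLimitPoints (hB : B ∈ normLimitPoints A) {X : H →L[ℂ] H}
    (h : ∀ᶠ n in atTop, X ≤ absPowRoot A n) (x : H) :
    (inner ℂ (X x) x).re ≤ (inner ℂ (B x) x).re := by
  obtain ⟨φ, hφ, hlim⟩ := hB
  exact ge_of_tendsto (tendsto_re_inner hlim x)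
    ((hφ.tendsto_atTop.eventually h).mono fun k hk => re_inner_le_of_le hk x)

theorem re_inner_le_of_mem_normLimitPoints (hB : B ∈ normLimitPoints A) {X : H →L[ℂ] H}
    (h : ∀ᶠ n in atTop, absPowRoot A n ≤ X) (x : H) :
    (inner ℂ (B x) x).re ≤ (inner ℂ (X x) x).re := by
  obtain ⟨φ, hφ, hlim⟩ := hB
  exact le_of_tendsto (tendsto_re_inner hlim x)
    ((hφ.tendsto_atTop.eventually h).mono fun k hk => re_inner_le_of_le hk x)

theorem nonneg_of_mem_normLimitPoints (hB : B ∈ normLimitPoints A) : 0 ≤ B := by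
  have hsa : IsSelfAdjoint B := by
    obtain ⟨φ, hφ, hlim⟩ := hB
    have h := (continuous_star.tendsto B).comp hlim
    refine tendsto_nhds_unique h (hlim.congr fun k => ?_)
    exact (IsSelfAdjoint.of_nonneg (CFC.rpow_nonneg)).star_eq.symm
  apply le_of_re_inner_le (IsSelfAdjoint.zero _) hsa
  exact le_re_inner_of_mem_normLimitPoints hB (Eventually.of_forall fun n => CFC.rpow_nonneg)

/-- Comparison with a block operator on the slow space and its complement. Splitting x costs a
factor 2 through (u + v)² ≤ 2u² + 2v². Enlarging s to a absorbs it on the slow space; on the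
complement any constant will do, and 2‖A‖ absorbs it there. -/
theorem re_inner_le_on_slowSpace (hA : IsCompactOperator A) (hB : B ∈ normLimitPoints A) {ρ : ℝ}
    (hρ : 0 < ρ) :
    ∃ a, 0 < a ∧ a < ρ ∧ ∀ x ∈ slowSpace A ρ, (inner ℂ (B x) x).re ≤ a * ‖x‖ ^ 2 := by
  obtain ⟨-, -, -, -, -, -, -, ⟨s, hs0, hsρ, hs⟩, -⟩ := exists_projection_slowSpace hA hρ
  obtain ⟨a, hsa, haρ⟩ := exists_between hsρ
  have ha0 := hs0.trans hsa
  have : CompleteSpace (slowSpace A ρ) := (isClosed_slowSpace hA hρ).completeSpace_coe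
  set F := (slowSpace A ρ)ᗮ with hF
  have hFF : Fᗮ = slowSpace A ρ := (slowSpace A ρ).orthogonal_orthogonal
  have hmem : ∀ x, x - F.starProjection x ∈ slowSpace A ρ := by
    intro x
    have h := F.sub_starProjection_mem_orthogonal x
    rwa [hFF] at h
  have ht : Tendsto (fun n : ℕ => 2 * ((s / a) ^ 2) ^ n) atTop (𝓝 (2 * 0)) := by
    refine (tendsto_pow_atTop_nhds_zero_of_lt_one (by positivity) ?_).const_mul 2
    exact pow_lt_one₀ (by positivity) ((div_lt_one ha0).mpr hsa) two_ne_zero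
  rw [mul_zero] at ht
  have hev : ∀ᶠ n : ℕ in atTop, absPowRoot A n ≤ blockOp F a (2 * ‖A‖) := by
    filter_upwards [hs, ht.eventually (gt_mem_nhds one_pos), eventually_gt_atTop 0]
      with n hn hn2 hn0
    apply norm_pow_le_imp_le_blockOp hn0 ha0.le (by positivity)
    intro x
    set y := F.starProjection x with hy
    have h1 := hn _ (hmem x)
    have h2 : ‖(A ^ n) y‖ ≤ ‖A‖ ^ n * ‖y‖ :=
      (A ^ n).le_of_opNorm_le (norm_pow_le' A hn0) y
    have h3 : ‖(A ^ n) x‖ ≤ ‖(A ^ n) (x - y)‖ + ‖(A ^ n) y‖ := by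
      have : (A ^ n) x = (A ^ n) (x - y) + (A ^ n) y := by rw [← map_add, sub_add_cancel]
      rw [this]
      exact norm_add_le _ _
    have h4 : ‖(A ^ n) x‖ ^ 2 ≤ 2 * (s ^ n * ‖x - y‖) ^ 2 + 2 * (‖A‖ ^ n * ‖y‖) ^ 2 := by
      calc ‖(A ^ n) x‖ ^ 2 ≤ (s ^ n * ‖x - y‖ + ‖A‖ ^ n * ‖y‖) ^ 2 :=
            pow_le_pow_left₀ (norm_nonneg _) (by linarith) 2
        _ ≤ _ := by nlinarith [sq_nonneg (s ^ n * ‖x - y‖ - ‖A‖ ^ n * ‖y‖)]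
    have h5 : 2 * (s ^ n) ^ 2 ≤ a ^ (2 * n) := by
      have h6 : 2 * ((s / a) ^ 2) ^ n = 2 * (s ^ n) ^ 2 / a ^ (2 * n) := by
        rw [← pow_mul, div_pow, mul_div_assoc, ← pow_mul, mul_comm n 2]
      rw [h6, div_lt_one (by positivity)] at hn2
      exact hn2.le
    have h7 : 2 * (‖A‖ ^ n) ^ 2 ≤ (2 * ‖A‖) ^ (2 * n) := by
      rw [mul_pow, ← pow_mul, mul_comm n 2]
      gcongr
      exact le_self_pow₀ one_le_two (by omega)
    calc ‖(A ^ n) x‖ ^ 2 ≤ _ := h4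
      _ = 2 * (s ^ n) ^ 2 * ‖x - y‖ ^ 2 + 2 * (‖A‖ ^ n) ^ 2 * ‖y‖ ^ 2 := by ring
      _ ≤ _ := by gcongr
  refine ⟨a, ha0, haρ, fun x hx => ?_⟩
  have h := re_inner_le_of_mem_normLimitPoints hB hev x
  have hx0 : F.starProjection x = 0 := by
    rw [Submodule.starProjection_apply_eq_zero_iff, hFF]
    exact hx
  rwa [re_inner_blockOp, hx0, sub_zero, norm_zero, zero_pow two_ne_zero, mul_zero, add_zero] at h

/-- The constant δ is harmless, as its n-th root tends to 1: for b < c, eventually bⁿ ≤ δcⁿ. Then b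
tends to ρ. -/
theorem le_re_inner_of_eventually {F : Submodule ℂ H} [F.HasOrthogonalProjection]
    (hB : B ∈ normLimitPoints A) {ρ : ℝ} (hρ : 0 < ρ)
    (h : ∀ c, 0 < c → c < ρ → ∃ δ > 0, ∀ᶠ n : ℕ in atTop, ∀ x,
      c ^ n * δ * ‖F.starProjection x‖ ≤ ‖(A ^ n) x‖) (x : H) :
    ρ * ‖F.starProjection x‖ ^ 2 ≤ (inner ℂ (B x) x).re := by
  have hb : ∀ b, 0 < b → b < ρ → b * ‖F.starProjection x‖ ^ 2 ≤ (inner ℂ (B x) x).re := by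
    intro b hb0 hbρ
    obtain ⟨c, hbc, hcρ⟩ := exists_between hbρ
    have hc0 := hb0.trans hbc
    obtain ⟨δ, hδ, hδ'⟩ := h c hc0 hcρ
    have ht : Tendsto (fun n : ℕ => (b / c) ^ n) atTop (𝓝 0) :=
      tendsto_pow_atTop_nhds_zero_of_lt_one (by positivity) ((div_lt_one hc0).mpr hbc)
    have hev : ∀ᶠ n : ℕ in atTop, blockOp F 0 b ≤ absPowRoot A n := by
      filter_upwards [hδ', ht.eventually (gt_mem_nhds hδ), eventually_gt_atTop 0] with n hn hn2 hn0
      refine le_norm_pow_imp_blockOp_le hn0 hb0.le fun x => le_trans ?_ (hn x)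
      rw [div_pow, div_lt_iff₀ (by positivity)] at hn2
      rw [mul_comm (c ^ n)]
      gcongr
    have h1 := le_re_inner_of_mem_normLimitPoints hB hev x
    rwa [re_inner_blockOp, zero_mul, zero_add] at h1
  have hcont : Tendsto (fun b => b * ‖F.starProjection x‖ ^ 2) (𝓝[<] ρ)
      (𝓝 (ρ * ‖F.starProjection x‖ ^ 2)) :=
    ((continuous_id.mul continuous_const).tendsto ρ).mono_left nhdsWithin_le_nhds
  refine le_of_tendsto hcont ?_
  filter_upwards [Ioo_mem_nhdsLT hρ] with b hb' using hb b hb'.1 hb'.2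

theorem le_re_inner_orthogonal_slowSpace (hA : IsCompactOperator A) (hB : B ∈ normLimitPoints A)
    {ρ : ℝ} (hρ : 0 < ρ) [(slowSpace A ρ)ᗮ.HasOrthogonalProjection] (x : H) :
    ρ * ‖(slowSpace A ρ)ᗮ.starProjection x‖ ^ 2 ≤ (inner ℂ (B x) x).re := by
  obtain ⟨Pr, hcomm, hidem, -, -, -, heq, -, hlow⟩ := exists_projection_slowSpace hA hρ
  refine le_re_inner_of_eventually hB hρ (fun c hc hcρ => ?_) x
  -- Since Pr commutes with Aⁿ, ‖Aⁿ Pr x‖ ≤ ‖Pr‖ ‖Aⁿx‖; the 1 covers Pr = 0.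
  refine ⟨(‖Pr‖ + 1)⁻¹, by positivity, (hlow c hc hcρ).mono fun n hn x => ?_⟩
  have h1 : ‖(slowSpace A ρ)ᗮ.starProjection x‖ ≤ ‖Pr x‖ := by
    have h : (slowSpace A ρ)ᗮ.starProjection (x - Pr x) = 0 := by
      rw [Submodule.starProjection_apply_eq_zero_iff]
      apply Submodule.le_orthogonal_orthogonal
      rw [← heq]
      exact show Pr (x - Pr x) = 0 by rw [map_sub, hidem, sub_self]
    rw [map_sub, sub_eq_zero] at h
    rw [h]
    exact Submodule.norm_starProjection_apply_le _ _
  have hcn : Pr ((A ^ n) x) = (A ^ n) (Pr x) := by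
    have : Commute Pr A := ContinuousLinearMap.ext hcomm
    exact congrArg (fun f : H →L[ℂ] H => f x) (this.pow_right n)
  have h2 : c ^ n * ‖Pr x‖ ≤ (‖Pr‖ + 1) * ‖(A ^ n) x‖ := by
    refine (hn x).trans ?_
    rw [← hcn]
    exact (Pr.le_opNorm _).trans (by gcongr; linarith)
  calc c ^ n * (‖Pr‖ + 1)⁻¹ * ‖(slowSpace A ρ)ᗮ.starProjection x‖
      ≤ c ^ n * (‖Pr‖ + 1)⁻¹ * ‖Pr x‖ := by gcongr
    _ = (‖Pr‖ + 1)⁻¹ * (c ^ n * ‖Pr x‖) := by ring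
    _ ≤ (‖Pr‖ + 1)⁻¹ * ((‖Pr‖ + 1) * ‖(A ^ n) x‖) := by gcongr
    _ = _ := by rw [← mul_assoc, inv_mul_cancel₀ (by positivity), one_mul]

end LimitPoint

/-! ### Positive operators and their quadratic forms -/

section PositiveOperator

variable {H : Type*} [NormedAddCommGroup H] [InnerProductSpace ℂ H] [CompleteSpace H]

theorem norm_sqrt_apply_sq {C : H →L[ℂ] H} (hC : 0 ≤ C) (x : H) :
    ‖CFC.sqrt C x‖ ^ 2 = (inner ℂ (C x) x).re := by
  rw [← re_inner_star_mul_self, (IsSelfAdjoint.of_nonneg (CFC.sqrt_nonneg C)).star_eq,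
    CFC.sqrt_mul_sqrt_self C hC]

theorem apply_eq_zero_of_re_inner_eq_zero {C : H →L[ℂ] H} (hC : 0 ≤ C) {x : H}
    (h : (inner ℂ (C x) x).re = 0) : C x = 0 := by
  rw [← norm_sqrt_apply_sq hC, sq_eq_zero_iff, norm_eq_zero] at h
  rw [← CFC.sqrt_mul_sqrt_self C hC, mul_apply_eq_comp, h, map_zero]

theorem isUnit_of_le_re_inner {B : H →L[ℂ] H} {c : ℝ} (hc : 0 < c)
    (h : ∀ x, c * ‖x‖ ^ 2 ≤ (inner ℂ (B x) x).re) : IsUnit B := by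
  refine ContinuousLinearMap.isUnit_of_forall_le_norm_inner_map B (c := ⟨c, hc.le⟩)
    (by exact_mod_cast hc) fun x => ?_
  rw [mul_comm]
  exact (h x).trans (Complex.re_le_norm _)

theorem exists_le_re_inner_of_isUnit {B : H →L[ℂ] H} (hB : 0 ≤ B) (hu : IsUnit B) :
    ∃ c, 0 < c ∧ ∀ x, c * ‖x‖ ^ 2 ≤ (inner ℂ (B x) x).re := by
  obtain ⟨u, hu⟩ := (CFC.isUnit_sqrt_iff B hB).mpr hu
  set K := ‖(↑u⁻¹ : H →L[ℂ] H)‖ + 1 with hK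
  refine ⟨(K ^ 2)⁻¹, by positivity, fun x => ?_⟩
  have h1 : (↑u⁻¹ : H →L[ℂ] H) (CFC.sqrt B x) = x := by
    rw [← hu]
    exact congrArg (fun f : H →L[ℂ] H => f x) u.inv_mul
  have h2 : ‖x‖ ≤ K * ‖CFC.sqrt B x‖ := by
    calc ‖x‖ = ‖(↑u⁻¹ : H →L[ℂ] H) (CFC.sqrt B x)‖ := by rw [h1]
      _ ≤ _ := ContinuousLinearMap.le_opNorm _ _
      _ ≤ _ := by gcongr; linarith
  rw [← norm_sqrt_apply_sq hB, inv_mul_le_iff₀ (by positivity), ← mul_pow]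
  exact pow_le_pow_left₀ (norm_nonneg _) h2 2

theorem inner_eq_zero_of_apply_eq_smul {B : H →L[ℂ] H} (hB : IsSelfAdjoint B) {μ ν : ℝ}
    (hne : μ ≠ ν) {x y : H} (hx : B x = (μ : ℂ) • x) (hy : B y = (ν : ℂ) • y) :
    inner ℂ x y = 0 := by
  have h : inner ℂ (B x) y = inner ℂ x (B y) :=
    (ContinuousLinearMap.isSelfAdjoint_iff_isSymmetric.mp hB) x y
  rw [hx, hy, inner_smul_left, inner_smul_right, Complex.conj_ofReal, ← sub_eq_zero, ← sub_mul,
    mul_eq_zero, sub_eq_zero] at h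
  exact h.resolve_left fun h' => hne (Complex.ofReal_injective h')

omit [CompleteSpace H] in
theorem re_inner_ofReal_smul_self (ρ : ℝ) (y : H) :
    (inner ℂ ((ρ : ℂ) • y) y).re = ρ * ‖y‖ ^ 2 := by
  rw [inner_smul_left, Complex.conj_ofReal, Complex.re_ofReal_mul]
  congr 1
  exact (norm_sq_eq_re_inner (𝕜 := ℂ) y).symm

omit [CompleteSpace H] in
theorem mem_ker_sub_smul_iff {B : H →L[ℂ] H} {z : ℂ} {x : H} :
    x ∈ LinearMap.ker (B - z • (1 : H →L[ℂ] H)).toLinearMap ↔ B x = z • x := by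
  rw [LinearMap.mem_ker]
  exact sub_eq_zero

end PositiveOperator

/-! ### Eigenspaces of the limit point -/

section Eigenspaces

variable {H : Type*} [NormedAddCommGroup H] [InnerProductSpace ℂ H] [CompleteSpace H]
  {A B : H →L[ℂ] H}

theorem algMultiplicity_pos (hA : IsCompactOperator A) {η : ℂ} (hη : η ≠ 0)
    (h : η ∈ spectrum ℂ A) : 0 < algMultiplicity A η := by
  obtain ⟨-, -, -, -, hfd, -⟩ := exists_projection_slowSpace hA (norm_pos_iff.mpr hη)
  have := hfd η h le_rfl
  obtain ⟨x, hx0, hx⟩ := exists_apply_eq_smul_of_mem_spectrum hA hη h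
  have hmem : x ∈ rootSpace A η :=
    Module.End.eigenspace_le_maxGenEigenspace (Module.End.mem_eigenspace_iff.mpr hx)
  have : Nontrivial (rootSpace A η) := ⟨⟨⟨x, hmem⟩, 0, fun h => hx0 (congrArg Subtype.val h)⟩⟩
  exact Module.finrank_pos

theorem orthogonal_orthogonal_slowSpace (hA : IsCompactOperator A) {ρ : ℝ} (hρ : 0 < ρ) :
    (slowSpace A ρ)ᗮᗮ = slowSpace A ρ := by
  have : CompleteSpace (slowSpace A ρ) := (isClosed_slowSpace hA hρ).completeSpace_coe
  exact (slowSpace A ρ).orthogonal_orthogonal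

/-- The two spaces are nested and have the same finite codimension. -/
theorem slowSpace_eq_of_spectrum_gap (hA : IsCompactOperator A) {ρ r : ℝ} (hρ : 0 < ρ)
    (hr : ρ ≤ r) (hgap : ∀ η ∈ spectrum ℂ A, ρ ≤ ‖η‖ → r ≤ ‖η‖) :
    slowSpace A ρ = slowSpace A r := by
  have hr0 := hρ.trans_le hr
  obtain ⟨h1, h2⟩ := finrank_orthogonal_slowSpace hA hρ
  obtain ⟨h3, h4⟩ := finrank_orthogonal_slowSpace hA hr0
  have hset : (finite_spectrum_norm_ge hA hρ).toFinset =
      (finite_spectrum_norm_ge hA hr0).toFinset := by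
    ext η
    simp only [Set.Finite.mem_toFinset, Set.mem_ofPred_eq]
    exact ⟨fun h => ⟨h.1, hgap η h.1 h.2⟩, fun h => ⟨h.1, hr.trans h.2⟩⟩
  have h5 : (slowSpace A r)ᗮ = (slowSpace A ρ)ᗮ :=
    Submodule.eq_of_le_of_finrank_eq (Submodule.orthogonal_le (slowSpace_mono A hr))
      (by rw [h2, h4, hset])
  rw [← orthogonal_orthogonal_slowSpace hA hρ, ← h5, orthogonal_orthogonal_slowSpace hA hr0]

theorem exists_spectrum_gap (hA : IsCompactOperator A) {ρ : ℝ} (hρ : 0 < ρ) :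
    ∃ r, ρ < r ∧ ∀ η ∈ spectrum ℂ A, ρ < ‖η‖ → r ≤ ‖η‖ := by
  have hfin : {η : ℂ | η ∈ spectrum ℂ A ∧ ρ < ‖η‖}.Finite :=
    (finite_spectrum_norm_ge hA hρ).subset fun η h => ⟨h.1, h.2.le⟩
  rcases Set.eq_empty_or_nonempty {η : ℂ | η ∈ spectrum ℂ A ∧ ρ < ‖η‖} with h | h
  · refine ⟨ρ + 1, by linarith, fun η hη hη' => ?_⟩
    have : η ∈ {η : ℂ | η ∈ spectrum ℂ A ∧ ρ < ‖η‖} := ⟨hη, hη'⟩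
    rw [h] at this
    exact absurd this (Set.notMem_empty η)
  · obtain ⟨ξ, hξ, hmin⟩ := Set.exists_min_image _ (fun η : ℂ => ‖η‖) hfin h
    exact ⟨‖ξ‖, hξ.2, fun η hη hη' => hmin η ⟨hη, hη'⟩⟩

/-- Across the gap the slow space at r is also the one at every t in (ρ, r), so the form is bounded
by t‖x‖²; let t decrease to ρ. -/
theorem re_inner_le_of_spectrum_gap (hA : IsCompactOperator A) (hB : B ∈ normLimitPoints A)
    {ρ r : ℝ} (hρ : 0 < ρ) (hr : ρ < r) (hgap : ∀ η ∈ spectrum ℂ A, ρ < ‖η‖ → r ≤ ‖η‖) {x : H}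
    (hx : x ∈ slowSpace A r) : (inner ℂ (B x) x).re ≤ ρ * ‖x‖ ^ 2 := by
  have hcont : Tendsto (fun b => b * ‖x‖ ^ 2) (𝓝[>] ρ) (𝓝 (ρ * ‖x‖ ^ 2)) :=
    ((continuous_id.mul continuous_const).tendsto ρ).mono_left nhdsWithin_le_nhds
  refine ge_of_tendsto hcont ?_
  filter_upwards [Ioo_mem_nhdsGT hr] with t ht
  have ht0 := hρ.trans ht.1
  rw [← slowSpace_eq_of_spectrum_gap hA ht0 ht.2.le
    fun η hη hη' => hgap η hη (ht.1.trans_le hη')] at hx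
  obtain ⟨a, ha0, hat, ha⟩ := re_inner_le_on_slowSpace hA hB ht0
  exact (ha x hx).trans (by gcongr)

/-- The operator C = B - ρQ is positive, and the upper bound on the slow space at r forces ⟨Cx,x⟩ =
0, hence Cx = 0. -/
theorem apply_eq_smul_of_mem_inf (hA : IsCompactOperator A) (hB : B ∈ normLimitPoints A)
    {ρ r : ℝ} (hρ : 0 < ρ) (hr : ρ < r) (hgap : ∀ η ∈ spectrum ℂ A, ρ < ‖η‖ → r ≤ ‖η‖) {x : H}
    (hx : x ∈ slowSpace A r) (hx' : x ∈ (slowSpace A ρ)ᗮ) : B x = (ρ : ℂ) • x := by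
  have : CompleteSpace (slowSpace A ρ) := (isClosed_slowSpace hA hρ).completeSpace_coe
  set C := B - blockOp (slowSpace A ρ)ᗮ 0 ρ with hC
  have hCnn : 0 ≤ C := by
    rw [hC, sub_nonneg]
    apply le_of_re_inner_le (isSelfAdjoint_blockOp _ _ _)
      (IsSelfAdjoint.of_nonneg (nonneg_of_mem_normLimitPoints hB))
    intro y
    rw [re_inner_blockOp, zero_mul, zero_add]
    exact le_re_inner_orthogonal_slowSpace hA hB hρ y
  have hQ : (slowSpace A ρ)ᗮ.starProjection x = x := Submodule.starProjection_eq_self_iff.mpr hx'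
  have hbx : blockOp (slowSpace A ρ)ᗮ 0 ρ x = (ρ : ℂ) • x := by
    simp [blockOp, hQ]
  have h0 : (inner ℂ (C x) x).re = 0 := by
    apply le_antisymm
    · have h1 := re_inner_blockOp (slowSpace A ρ)ᗮ 0 ρ x
      rw [hQ, zero_mul, zero_add] at h1
      rw [hC, sub_apply, inner_sub_left, Complex.sub_re, h1, sub_nonpos]
      exact re_inner_le_of_spectrum_gap hA hB hρ hr hgap hx
    · rw [← norm_sqrt_apply_sq hCnn]
      positivity
  have h1 := apply_eq_zero_of_re_inner_eq_zero hCnn h0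
  rwa [hC, sub_apply, hbx, sub_eq_zero] at h1

theorem exists_slowSpace_add_eigenvector (hA : IsCompactOperator A) (hB : B ∈ normLimitPoints A)
    {ρ r : ℝ} (hρ : 0 < ρ) (hr : ρ < r) (hgap : ∀ η ∈ spectrum ℂ A, ρ < ‖η‖ → r ≤ ‖η‖) {x : H}
    (hx : x ∈ slowSpace A r) :
    ∃ y ∈ slowSpace A ρ, ∃ e ∈ (slowSpace A ρ)ᗮ, e ∈ slowSpace A r ∧ x = y + e ∧
      B e = (ρ : ℂ) • e := by
  have : CompleteSpace (slowSpace A ρ) := (isClosed_slowSpace hA hρ).completeSpace_coe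
  set y := (slowSpace A ρ).starProjection x with hy
  have hyW : y ∈ slowSpace A ρ := (slowSpace A ρ).starProjection_apply_mem x
  have he : x - y ∈ (slowSpace A ρ)ᗮ := (slowSpace A ρ).sub_starProjection_mem_orthogonal x
  have her : x - y ∈ slowSpace A r := sub_mem hx (slowSpace_mono A hr.le hyW)
  exact ⟨y, hyW, x - y, he, her, by abel, apply_eq_smul_of_mem_inf hA hB hρ hr hgap her he⟩

/-- Induction on the codimension. Let |ξ| be the least spectral modulus ≥ ρ. Past it the codimension
drops, so x is slow at the next level and splits as y + e with Be = |ξ|e. As μ < |ξ|, e is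
orthogonal to x; it is also orthogonal to y, so e = 0. -/
theorem mem_slowSpace_of_apply_eq_smul_of_finrank_le (hA : IsCompactOperator A)
    (hB : B ∈ normLimitPoints A) (n : ℕ) :
    ∀ ρ, 0 < ρ → Module.finrank ℂ (slowSpace A ρ)ᗮ ≤ n → ∀ (μ : ℝ), μ < ρ → ∀ x,
      B x = (μ : ℂ) • x → x ∈ slowSpace A ρ := by
  induction n with
  | zero =>
    intro ρ hρ hn μ _ x _
    have := (finrank_orthogonal_slowSpace hA hρ).1
    have h := Submodule.finrank_eq_zero.mp (Nat.le_zero.mp hn)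
    rw [← orthogonal_orthogonal_slowSpace hA hρ, h, Submodule.bot_orthogonal_eq_top]
    exact Submodule.mem_top
  | succ n ih =>
    intro ρ hρ hn μ hμ x hx
    obtain ⟨hfd, hrank⟩ := finrank_orthogonal_slowSpace hA hρ
    rcases Set.eq_empty_or_nonempty {η : ℂ | η ∈ spectrum ℂ A ∧ ρ ≤ ‖η‖} with hS | hS
    · apply ih ρ hρ _ μ hμ x hx
      rw [hrank, (Set.Finite.toFinset_eq_empty).mpr hS, Finset.sum_empty]
      exact Nat.zero_le n
    · obtain ⟨ξ, hξ, hmin⟩ := Set.exists_min_image _ (fun η : ℂ => ‖η‖)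
        (finite_spectrum_norm_ge hA hρ) hS
      have hξ0 : 0 < ‖ξ‖ := hρ.trans_le hξ.2
      obtain ⟨r, hr, hgap⟩ := exists_spectrum_gap hA hξ0
      have hr0 := hξ0.trans hr
      have hlt : Module.finrank ℂ (slowSpace A r)ᗮ < Module.finrank ℂ (slowSpace A ρ)ᗮ := by
        rw [hrank, (finrank_orthogonal_slowSpace hA hr0).2]
        refine Finset.sum_lt_sum_of_subset (i := ξ) ?_ ?_ ?_
          (algMultiplicity_pos hA (norm_pos_iff.mp hξ0) hξ.1) fun _ _ _ => Nat.zero_le _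
        · intro η hη
          simp only [Set.Finite.mem_toFinset, Set.mem_ofPred_eq] at hη ⊢
          exact ⟨hη.1, (hξ.2.trans hr.le).trans hη.2⟩
        · simpa only [Set.Finite.mem_toFinset] using hξ
        · simp only [Set.Finite.mem_toFinset, Set.mem_ofPred_eq, not_and, not_le]
          exact fun _ => hr
      have hxr : x ∈ slowSpace A r :=
        ih r hr0 (by omega) μ (hμ.trans (hξ.2.trans_lt hr)) x hx
      obtain ⟨y, hy, e, he, -, hxe, hBe⟩ := exists_slowSpace_add_eigenvector hA hB hξ0 hr hgap hxr
      have h0 : inner ℂ e x = 0 :=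
        inner_eq_zero_of_apply_eq_smul (IsSelfAdjoint.of_nonneg (nonneg_of_mem_normLimitPoints hB))
          (hμ.trans_le hξ.2).ne' hBe hx
      have hey : inner ℂ e y = 0 := Submodule.inner_left_of_mem_orthogonal hy he
      rw [hxe, inner_add_right, hey, zero_add, inner_self_eq_zero] at h0
      rw [slowSpace_eq_of_spectrum_gap hA hρ hξ.2 fun η hη hη' => hmin η ⟨hη, hη'⟩, hxe, h0,
        add_zero]
      exact hy

theorem ker_sub_smul_eq (hA : IsCompactOperator A) (hB : B ∈ normLimitPoints A)
    {ρ r : ℝ} (hρ : 0 < ρ) (hr : ρ < r) (hgap : ∀ η ∈ spectrum ℂ A, ρ < ‖η‖ → r ≤ ‖η‖) :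
    LinearMap.ker (B - (ρ : ℂ) • (1 : H →L[ℂ] H)).toLinearMap =
      (slowSpace A r)ᗮᗮ ⊓ (slowSpace A ρ)ᗮ := by
  rw [orthogonal_orthogonal_slowSpace hA (hρ.trans hr)]
  ext x
  rw [mem_ker_sub_smul_iff, Submodule.mem_inf]
  refine ⟨fun hx => ?_, fun h => apply_eq_smul_of_mem_inf hA hB hρ hr hgap h.1 h.2⟩
  have hxr : x ∈ slowSpace A r :=
    mem_slowSpace_of_apply_eq_smul_of_finrank_le hA hB _ r (hρ.trans hr) le_rfl ρ hr x hx
  obtain ⟨y, hy, e, he, -, hxe, hBe⟩ := exists_slowSpace_add_eigenvector hA hB hρ hr hgap hxr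
  have hBy : B y = (ρ : ℂ) • y := by
    have : y = x - e := by rw [hxe]; abel
    rw [this, map_sub, hx, hBe, smul_sub]
  obtain ⟨a, -, haρ, ha⟩ := re_inner_le_on_slowSpace hA hB hρ
  have h1 := ha y hy
  rw [hBy, re_inner_ofReal_smul_self] at h1
  -- The slow part y is also an eigenvector for ρ, against the form bound a < ρ.
  have hy0 : y = 0 := by
    by_contra hy0
    have : 0 < ‖y‖ ^ 2 := by positivity
    exact absurd (le_of_mul_le_mul_right h1 this) (not_le.mpr haρ)
  rw [hxe, hy0, zero_add] at hxr ⊢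
  exact ⟨hxr, he⟩

theorem finite_spectrum_norm_eq (hA : IsCompactOperator A) {ρ : ℝ} (hρ : 0 < ρ) :
    {η : ℂ | η ∈ spectrum ℂ A ∧ ‖η‖ = ρ}.Finite :=
  (finite_spectrum_norm_ge hA hρ).subset fun _ h => ⟨h.1, h.2.ge⟩

theorem finrank_ker_sub_smul (hA : IsCompactOperator A) (hB : B ∈ normLimitPoints A)
    {ρ : ℝ} (hρ : 0 < ρ) :
    FiniteDimensional ℂ (LinearMap.ker (B - (ρ : ℂ) • (1 : H →L[ℂ] H)).toLinearMap) ∧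
    Module.finrank ℂ (LinearMap.ker (B - (ρ : ℂ) • (1 : H →L[ℂ] H)).toLinearMap) =
      ∑ η ∈ (finite_spectrum_norm_eq hA hρ).toFinset, algMultiplicity A η := by
  classical
  obtain ⟨r, hr, hgap⟩ := exists_spectrum_gap hA hρ
  obtain ⟨hfd, hrank⟩ := finrank_orthogonal_slowSpace hA hρ
  have hrank' := (finrank_orthogonal_slowSpace hA (hρ.trans hr)).2
  rw [ker_sub_smul_eq hA hB hρ hr hgap]
  refine ⟨Submodule.finiteDimensional_inf_right _ _, ?_⟩
  -- The double complement in `ker_sub_smul_eq` matches this dimension formula for nested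
  -- finite-dimensional spaces.
  have h := Submodule.finrank_add_inf_finrank_orthogonal
    (Submodule.orthogonal_le (slowSpace_mono A hr.le))
  have hunion : (finite_spectrum_norm_ge hA hρ).toFinset =
      (finite_spectrum_norm_ge hA (hρ.trans hr)).toFinset ∪
        (finite_spectrum_norm_eq hA hρ).toFinset := by
    ext η
    simp only [Finset.mem_union, Set.Finite.mem_toFinset, Set.mem_ofPred_eq]
    constructor
    · rintro ⟨h1, h2⟩
      rcases h2.lt_or_eq with h3 | h3
      · exact Or.inl ⟨h1, hgap η h1 h3⟩
      · exact Or.inr ⟨h1, h3.symm⟩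
    · rintro (⟨h1, h2⟩ | ⟨h1, h2⟩)
      · exact ⟨h1, hr.le.trans h2⟩
      · exact ⟨h1, h2.ge⟩
  have hdisj : Disjoint (finite_spectrum_norm_ge hA (hρ.trans hr)).toFinset
      (finite_spectrum_norm_eq hA hρ).toFinset := by
    rw [Finset.disjoint_left]
    intro η h1 h2
    simp only [Set.Finite.mem_toFinset, Set.mem_ofPred_eq] at h1 h2
    linarith [h1.2, h2.2]
  rw [hrank, hrank', hunion, Finset.sum_union hdisj] at h
  exact Nat.add_left_cancel h

end Eigenspaces

/-! ### Compactness of the limit point and equality of spectra -/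

section Spectrum

variable {H : Type*} [NormedAddCommGroup H] [InnerProductSpace ℂ H] [CompleteSpace H]
  {A B : H →L[ℂ] H}

/-- As ‖√B w‖² = ⟨Bw,w⟩, the form bound on the slow space at ε² says that √B has norm at most ε
there. Since that space has finite codimension, √B is a norm limit of finite-rank operators. -/
theorem isCompactOperator_of_mem_normLimitPoints (hA : IsCompactOperator A)
    (hB : B ∈ normLimitPoints A) : IsCompactOperator B := by
  have hBnn := nonneg_of_mem_normLimitPoints hB
  set S := CFC.sqrt B with hS
  suffices hSc : IsCompactOperator S by
    have := hSc.clm_comp S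
    rw [← CFC.sqrt_mul_sqrt_self B hBnn]
    exact this
  have hex : ∀ ε : ℝ, 0 < ε → ∃ T : H →L[ℂ] H, IsCompactOperator T ∧ ‖T - S‖ ≤ ε := by
    intro ε hε
    have hε2 : 0 < ε ^ 2 := by positivity
    have : CompleteSpace (slowSpace A (ε ^ 2)) := (isClosed_slowSpace hA hε2).completeSpace_coe
    have := (finrank_orthogonal_slowSpace hA hε2).1
    have : ProperSpace (slowSpace A (ε ^ 2))ᗮ := FiniteDimensional.proper ℂ _
    refine ⟨S * (slowSpace A (ε ^ 2))ᗮ.starProjection, ?_, ?_⟩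
    · exact ((isCompactOperator_of_locallyCompactSpace_rng
        (slowSpace A (ε ^ 2))ᗮ.subtypeL).comp_clm
          (slowSpace A (ε ^ 2))ᗮ.orthogonalProjectionOnto).clm_comp S
    · apply ContinuousLinearMap.opNorm_le_bound _ hε.le
      intro x
      set w := (slowSpace A (ε ^ 2)).starProjection x with hw
      have hwx : (slowSpace A (ε ^ 2))ᗮ.starProjection x = x - w := by
        rw [Submodule.starProjection_orthogonal_val]
      have h1 : (S * (slowSpace A (ε ^ 2))ᗮ.starProjection - S) x = - S w := by
        rw [sub_apply, mul_apply_eq_comp, hwx, map_sub]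
        abel
      rw [h1, norm_neg]
      obtain ⟨a, -, ha, ha'⟩ := re_inner_le_on_slowSpace hA hB hε2
      have h2 := ha' w ((slowSpace A (ε ^ 2)).starProjection_apply_mem x)
      rw [← norm_sqrt_apply_sq hBnn] at h2
      have h3 : ‖w‖ ≤ ‖x‖ := Submodule.norm_starProjection_apply_le _ _
      refine le_of_sq_le_sq (h2.trans ?_) (by positivity)
      rw [mul_pow]
      gcongr
  choose! T hTc hT using hex
  refine isCompactOperator_of_tendsto (l := atTop) (F := fun n : ℕ => T (1 / ((n : ℝ) + 1))) ?_
    (Eventually.of_forall fun n => hTc _ (by positivity))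
  rw [tendsto_iff_norm_sub_tendsto_zero]
  exact squeeze_zero (fun _ => norm_nonneg _) (fun n => hT _ (by positivity))
    tendsto_one_div_add_atTop_nhds_zero_nat

theorem isUnit_of_isUnit_of_mem_normLimitPoints (hB : B ∈ normLimitPoints A) (hu : IsUnit A) :
    IsUnit B := by
  obtain ⟨u, rfl⟩ := hu
  set K := ‖(↑u⁻¹ : H →L[ℂ] H)‖ + 1 with hK
  have hK0 : 0 < K := by positivity
  have h1 : ∀ n : ℕ, ∀ x, ‖x‖ ≤ K ^ n * ‖((u : H →L[ℂ] H) ^ n) x‖ := by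
    intro n
    induction n with
    | zero => intro x; simp
    | succ n ih =>
      intro x
      have h2 : (↑u⁻¹ : H →L[ℂ] H) ((u : H →L[ℂ] H) x) = x :=
        congrArg (fun f : H →L[ℂ] H => f x) u.inv_mul
      have h3 : ‖x‖ ≤ K * ‖(u : H →L[ℂ] H) x‖ := by
        calc ‖x‖ = ‖(↑u⁻¹ : H →L[ℂ] H) ((u : H →L[ℂ] H) x)‖ := by rw [h2]
          _ ≤ _ := ContinuousLinearMap.le_opNorm _ _
          _ ≤ _ := by gcongr; linarith
      calc ‖x‖ ≤ K * ‖(u : H →L[ℂ] H) x‖ := h3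
        _ ≤ K * (K ^ n * ‖((u : H →L[ℂ] H) ^ n) ((u : H →L[ℂ] H) x)‖) := by gcongr; exact ih _
        _ = _ := by rw [pow_succ, pow_succ, mul_apply_eq_comp]; ring
  have htop : ∀ x, (⊤ : Submodule ℂ H).starProjection x = x := fun x =>
    Submodule.starProjection_eq_self_iff.mpr Submodule.mem_top
  refine isUnit_of_le_re_inner (c := K⁻¹) (by positivity) fun x => ?_
  have h := le_re_inner_of_eventually (F := (⊤ : Submodule ℂ H)) hB (ρ := K⁻¹) (by positivity)
    (fun c hc hcK => ⟨1, one_pos, Eventually.of_forall fun n x => ?_⟩) x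
  · rwa [htop] at h
  · rw [mul_one, htop]
    calc c ^ n * ‖x‖ ≤ K⁻¹ ^ n * ‖x‖ := by gcongr
      _ ≤ K⁻¹ ^ n * (K ^ n * ‖((u : H →L[ℂ] H) ^ n) x‖) := by gcongr; exact h1 n x
      _ = _ := by rw [← mul_assoc, ← mul_pow, inv_mul_cancel₀ hK0.ne', one_pow, one_mul]

/-- If B ≥ c > 0, the slow space at c is zero. Its codimension is finite, so H is finite
dimensional; and it contains ker A, so A is injective. -/
theorem isUnit_of_mem_normLimitPoints_of_isUnit (hA : IsCompactOperator A)
    (hB : B ∈ normLimitPoints A) (hu : IsUnit B) : IsUnit A := by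
  obtain ⟨c, hc, hcB⟩ := exists_le_re_inner_of_isUnit (nonneg_of_mem_normLimitPoints hB) hu
  obtain ⟨a, -, hac, ha⟩ := re_inner_le_on_slowSpace hA hB hc
  have hbot : slowSpace A c = ⊥ := by
    rw [eq_bot_iff]
    intro x hx
    by_contra hx0
    have hx1 : 0 < ‖x‖ ^ 2 := by
      have : x ≠ 0 := hx0
      positivity
    exact absurd (le_of_mul_le_mul_right ((hcB x).trans (ha x hx)) hx1) (not_le.mpr hac)
  have hfd := (finrank_orthogonal_slowSpace hA hc).1
  rw [hbot, Submodule.bot_orthogonal_eq_top] at hfd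
  have : FiniteDimensional ℂ H := Submodule.topEquiv.finiteDimensional
  have hinj : Function.Injective (A : H →ₗ[ℂ] H) := by
    rw [injective_iff_map_eq_zero]
    intro x hx
    have hx' : A x = 0 := hx
    have : x ∈ slowSpace A c := by
      rw [mem_slowSpace hc]
      refine ⟨c / 2, by positivity, by linarith, 0, ?_⟩
      filter_upwards [eventually_gt_atTop 0] with n hn
      obtain ⟨k, rfl⟩ := Nat.exists_eq_succ_of_ne_zero hn.ne'
      rw [pow_succ, mul_apply_eq_comp, hx', map_zero, norm_zero, zero_mul]
    rw [hbot] at this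
    exact this
  rw [ContinuousLinearMap.isUnit_iff_bijective]
  exact ⟨hinj, LinearMap.injective_iff_surjective.mp hinj⟩

theorem spectrum_eq_of_mem_normLimitPoints (hA : IsCompactOperator A)
    (hB : B ∈ normLimitPoints A) :
    spectrum ℂ B = {z : ℂ | ∃ l ∈ spectrum ℂ A, z = ((‖l‖ : ℝ) : ℂ)} := by
  have hBnn := nonneg_of_mem_normLimitPoints hB
  have h0 : (0 : ℂ) ∈ spectrum ℂ B ↔ (0 : ℂ) ∈ spectrum ℂ A := by
    rw [spectrum.zero_mem_iff, spectrum.zero_mem_iff]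
    exact not_congr ⟨isUnit_of_mem_normLimitPoints_of_isUnit hA hB,
      isUnit_of_isUnit_of_mem_normLimitPoints hB⟩
  ext z
  constructor
  · intro hz
    by_cases hz0 : z = 0
    · rw [hz0] at hz ⊢
      exact ⟨0, h0.mp hz, by simp⟩
    · obtain ⟨x, hx0, hx⟩ := exists_apply_eq_smul_of_mem_spectrum
        (isCompactOperator_of_mem_normLimitPoints hA hB) hz0 hz
      have hre : z = (z.re : ℂ) := (IsSelfAdjoint.of_nonneg hBnn).mem_spectrum_eq_re hz
      have hpos : 0 < z.re := by
        have h1 : 0 ≤ (inner ℂ (B x) x).re := by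
          rw [← norm_sqrt_apply_sq hBnn]
          positivity
        rw [hx, hre, re_inner_ofReal_smul_self] at h1
        have h4 : 0 ≤ z.re := nonneg_of_mul_nonneg_left h1 (by positivity)
        refine lt_of_le_of_ne h4 fun h5 => hz0 ?_
        rw [hre, ← h5, Complex.ofReal_zero]
      obtain ⟨hfd, hrank⟩ := finrank_ker_sub_smul hA hB hpos
      rcases (finite_spectrum_norm_eq hA hpos).toFinset.eq_empty_or_nonempty with hS | ⟨η, hη⟩
      · rw [hS, Finset.sum_empty, Submodule.finrank_eq_zero] at hrank
        have : x ∈ LinearMap.ker (B - (z.re : ℂ) • (1 : H →L[ℂ] H)).toLinearMap := by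
          rw [mem_ker_sub_smul_iff, ← hre, hx]
        rw [hrank] at this
        exact absurd this hx0
      · simp only [Set.Finite.mem_toFinset, Set.mem_ofPred_eq] at hη
        exact ⟨η, hη.1, by rw [hη.2, ← hre]⟩
  · rintro ⟨l, hl, rfl⟩
    by_cases hl0 : l = 0
    · rw [hl0] at hl ⊢
      simpa using h0.mpr hl
    · have hl1 : 0 < ‖l‖ := norm_pos_iff.mpr hl0
      obtain ⟨hfd, hrank⟩ := finrank_ker_sub_smul hA hB hl1
      have hpos : 0 < ∑ η ∈ (finite_spectrum_norm_eq hA hl1).toFinset, algMultiplicity A η :=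
        Finset.sum_pos' (fun _ _ => Nat.zero_le _)
          ⟨l, by simp [hl], algMultiplicity_pos hA hl0 hl⟩
      rw [← hrank, Module.finrank_pos_iff] at hpos
      obtain ⟨x, hx⟩ := exists_ne (0 : LinearMap.ker (B - (‖l‖ : ℂ) • (1 : H →L[ℂ] H)).toLinearMap)
      exact mem_spectrum_of_apply_eq_smul (fun h => hx (Subtype.ext h))
        (mem_ker_sub_smul_iff.mp x.2)

end Spectrum

theorem mainTheorem3 {H : Type*} [NormedAddCommGroup H] [InnerProductSpace ℂ H] [CompleteSpace H]
    [TopologicalSpace.SeparableSpace H] (A : H →L[ℂ] H) (hA : IsCompactOperator A)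
    (hA1 : ‖A‖ < 1) (B : H →L[ℂ] H) (hB : B ∈ normLimitPoints A) :
    spectrum ℂ B = {z : ℂ | ∃ l ∈ spectrum ℂ A, z = ((‖l‖ : ℝ) : ℂ)} ∧
    ∀ l : ℂ, l ≠ 0 →
      {η : ℂ | η ∈ spectrum ℂ A ∧ ‖η‖ = ‖l‖}.Finite ∧
      (∀ η : ℂ, η ∈ spectrum ℂ A → ‖η‖ = ‖l‖ → FiniteDimensional ℂ (rootSpace A η)) ∧
      FiniteDimensional ℂ (LinearMap.ker (B - ((‖l‖ : ℝ) : ℂ) • (1 : H →L[ℂ] H)).toLinearMap) ∧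
      Module.finrank ℂ (LinearMap.ker (B - ((‖l‖ : ℝ) : ℂ) • (1 : H →L[ℂ] H)).toLinearMap) =
        ∑ᶠ η ∈ {η : ℂ | η ∈ spectrum ℂ A ∧ ‖η‖ = ‖l‖}, algMultiplicity A η := by
  refine ⟨spectrum_eq_of_mem_normLimitPoints hA hB, fun l hl => ?_⟩
  have hl0 : 0 < ‖l‖ := norm_pos_iff.mpr hl
  obtain ⟨-, -, -, -, hroot, -⟩ := exists_projection_slowSpace hA hl0
  obtain ⟨hfd, hrank⟩ := finrank_ker_sub_smul hA hB hl0
  refine ⟨finite_spectrum_norm_eq hA hl0, fun η hη hηl => hroot η hη hηl.ge, hfd, ?_⟩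
  rw [hrank, finsum_mem_eq_finite_toFinset_sum _ (finite_spectrum_norm_eq hA hl0)]
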